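/- Let $M$ be a compact, oriented, smooth Riemannian manifold of dimension $n\ge 1$ with (possibly empty) boundary $\partial M$, which carries the boundary orientation. Let $\mu_{\mathrm{vol}}$ be its volume form, $*$ its Hodge star, $\Omega^k(M)$ the smooth $k$-forms on $M$, and $i:\partial M\to M$ the inclusion; write $\eta|_{\partial M}=i^*\eta$. Put $\mathfrak g=\Omega^{n-1}(M)$ and $\mathfrak g^*=\Omega^1(M)$, paired by $\langle\alpha|\omega\rangle_{\mathfrak g}=\int_M\alpha\wedge\omega$. For $\omega\in\mathfrak g$ let $\hat\omega$ be the vector field with $\iota_{\hat\omega}\mu_{\mathrm{vol}}=\omega$. Let $V=\Omega^k(M)$ and $V^*=\Omega^{n-k}(M)$, paired by $\langle\bar a|a\rangle_{V^*}=\int_M\bar a\wedge a$. For $a\in V^*$ let $$\tilde\varphi_a:\mathfrak g\to V^*,\qquad \tilde\varphi_a(\omega)=\mathcal L_{\hat\omega}a .$$ A formal dual of $\tilde\varphi_a$ is a map $\tilde\varphi_a^*:V\to\mathfrak g^*$ such that $\langle\tilde\varphi_a^*(\bar a)|\omega\rangle_{\mathfrak g}=\langle\bar a|\tilde\varphi_a(\omega)\rangle_{V^*}$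 for all $\bar a\in V$ and all $\omega\in\mathfrak g$ whose support lies in the interior of $M$. In each of the following two cases, for every $a\in V^*$ the map $\tilde\varphi_a$ does take values in $V^*$ and has exactly one formal dual $\tilde\varphi_a^*$, and for all $\omega\in\mathfrak g$ and $\bar a\in V$ $$\langle\tilde\varphi_a^*(\bar a)|\omega\rangle_{\mathfrak g}=\langle\bar a|\tilde\varphi_a(\omega)\rangle_{V^*}+\int_{\partial M}\eta_{\tilde\varphi_a}(\omega,\bar a)|_{\partial M},$$ where $\tilde\varphi_a^*(\bar a)\in\Omega^1(M)$ and the surface term $\eta_{\tilde\varphi_a}(\omega,\bar a)\in\Omega^{n-1}(M)$ are given as follows. 1. If $V=\Omega^0(M)$ and $V^*=\Omega^n(M)$, then $$\tilde\varphi_a^*(\bar a)=-(*a)\,d\bar a,\qquad \eta_{\tilde\varphi_a}(\omega,\bar a)=-(*a)\,\omega\wedge\bar a .$$ 2. If $V=\Omega^n(M)$ and $V^*=\Omega^0(M)$, then $$\tilde\varphi_a^*(\bar a)=(*\bar a)\,da,\qquad \eta_{\tilde\varphi_a}(\omega,\bar a)=0 .$$ -/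

import Mathlib

open Set Filter Topology MeasureTheory Module Bundle
open scoped Manifold ContDiff

noncomputable section

namespace FluidForms

/-! ### Multilinear algebra on a finite-dimensional real vector space -/

theorem update_id_apply {T : Type*} [AddCommGroup T] [Module ℝ T] {k : ℕ} (L : T →ₗ[ℝ] T) (w : Fin k → T) (j : Fin k) :
    (fun i => (Function.update (fun _ => LinearMap.id) j L : Fin k → T →ₗ[ℝ] T) i (w i)) =
      Function.update w j (L (w j)) := by
  funext i
  by_cases h : i = j
  · subst h
    simp
  · simp [h]

section Algebra

variable {T : Type*} [AddCommGroup T] [Module ℝ T] [TopologicalSpace T]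
  [IsTopologicalAddGroup T] [ContinuousSMul ℝ T] [T2Space T] [FiniteDimensional ℝ T]

theorem continuous_alternating {k : ℕ} (f : T [⋀^Fin k]→ₗ[ℝ] ℝ) : Continuous f := by
  let b := finBasis ℝ T
  have h : (f : (Fin k → T) → ℝ) = fun v => ∑ r : Fin k → Fin (finrank ℝ T),
      (∏ i, b.coord (r i) (v i)) * f (fun i => b (r i)) := by
    funext v
    have hv : v = fun i => ∑ j, b.coord j (v i) • b j := by
      funext i
      exact (b.sum_repr (v i)).symm
    conv_lhs => rw [hv]
    change f.toMultilinearMap _ = _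
    rw [MultilinearMap.map_sum]
    refine Finset.sum_congr rfl fun r _ => ?_
    rw [MultilinearMap.map_smul_univ]
    rfl
  rw [h]
  refine continuous_finsetSum _ fun r _ => Continuous.mul ?_ continuous_const
  refine continuous_finsetProd _ fun i _ => ?_
  exact (LinearMap.continuous_of_finiteDimensional (b.coord (r i))).comp (continuous_apply i)

/-- An alternating form on a finite-dimensional space, as a continuous alternating form. -/
def toCont {k : ℕ} (f : T [⋀^Fin k]→ₗ[ℝ] ℝ) : T [⋀^Fin k]→L[ℝ] ℝ :=
  { f with cont := continuous_alternating f }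

/-- The wedge product: the sum over all `(k, l)`-shuffles `σ` of
`sign σ * α (v_{σ 1}, …, v_{σ k}) * β (v_{σ (k+1)}, …, v_{σ (k+l)})`. -/
def wedgeAt {k l r : ℕ} (h : k + l = r) (α : T [⋀^Fin k]→L[ℝ] ℝ) (β : T [⋀^Fin l]→L[ℝ] ℝ) :
    T [⋀^Fin r]→L[ℝ] ℝ :=
  toCont (((LinearMap.mul' ℝ ℝ).compAlternatingMap
    (α.toAlternatingMap.domCoprod β.toAlternatingMap)).domDomCongr
      (finSumFinEquiv.trans (finCongr h)))

/-- The interior product `ι_v α = α (v, ·, …, ·)`. -/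
def interiorAt {k : ℕ} (v : T) (α : T [⋀^Fin (k + 1)]→L[ℝ] ℝ) : T [⋀^Fin k]→L[ℝ] ℝ :=
  toCont (α.toAlternatingMap.curryLeft v)

/-- `α (w 0, …, w (k - 1), ·, …, ·)`. -/
def contractFirst {l : ℕ} :
    (k : ℕ) → (T [⋀^Fin (l + k)]→L[ℝ] ℝ) → (Fin k → T) → T [⋀^Fin l]→L[ℝ] ℝ
  | 0, α, _ => α
  | k + 1, α, w => contractFirst k (interiorAt (w 0) α) (fun i => w i.succ)

/-- The action of an endomorphism `L` on `α` as a derivation: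
`(w 0, …, w (k - 1)) ↦ ∑ j, α (w 0, …, L (w j), …, w (k - 1))`. -/
def derivAct {k : ℕ} (L : T →ₗ[ℝ] T) (α : T [⋀^Fin k]→L[ℝ] ℝ) : T [⋀^Fin k]→L[ℝ] ℝ :=
  toCont
    { ∑ j : Fin k, α.toMultilinearMap.compLinearMap
        (Function.update (fun _ => LinearMap.id) j L) with
      map_eq_zero_of_eq' := by
        intro v i i' hv hi
        change (∑ j : Fin k, α.toMultilinearMap.compLinearMap
          (Function.update (fun _ => LinearMap.id) j L)) v = 0
        simp only [_root_.sum_apply, MultilinearMap.compLinearMap_apply,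
          update_id_apply]
        change ∑ j : Fin k, α (Function.update v j (L (v j))) = 0
        rw [← Finset.sum_subset (Finset.subset_univ {i, i'})]
        · rw [Finset.sum_pair hi]
          have hs : Function.update v i' (L (v i')) =
              Function.update v i (L (v i)) ∘ Equiv.swap i i' := by
            funext j
            by_cases h1 : j = i
            · subst h1
              simp [hi, Ne.symm hi, hv]
            · by_cases h2 : j = i'
              · subst h2
                simp [hv]
              · simp [Equiv.swap_apply_of_ne_of_ne h1 h2, h1, h2]
          rw [hs]
          have h := α.toAlternatingMap.map_swap (Function.update v i (L (v i))) hi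
          change _ + α.toAlternatingMap _ = 0
          rw [h]
          change α _ + -α _ = 0
          ring
        · intro j _ hj
          simp only [Finset.mem_insert, Finset.mem_singleton, not_or] at hj
          refine α.map_eq_zero_of_eq _ (i := i) (j := i') ?_ hi
          simp [Ne.symm hj.1, Ne.symm hj.2, hv] }

theorem derivAct_apply {k : ℕ} (L : T →ₗ[ℝ] T) (α : T [⋀^Fin k]→L[ℝ] ℝ) (w : Fin k → T) :
    derivAct L α w = ∑ j, α (Function.update w j (L (w j))) := by
  change (∑ j : Fin k, α.toMultilinearMap.compLinearMap
    (Function.update (fun _ => LinearMap.id) j L)) w = _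
  simp only [_root_.sum_apply, MultilinearMap.compLinearMap_apply, update_id_apply]
  rfl

end Algebra

/-! ### Differential forms on a manifold with boundary of dimension `m + 1` -/

section Forms

variable {m : ℕ} {M : Type*} [TopologicalSpace M] [ChartedSpace (EuclideanHalfSpace (m + 1)) M]

/-- A (not necessarily smooth) differential `k`-form on the `(m + 1)`-dimensional manifold `M`. -/
abbrev DForm (m : ℕ) (M : Type*) [TopologicalSpace M]
    [ChartedSpace (EuclideanHalfSpace (m + 1)) M] (k : ℕ) :=
  (x : M) → TangentSpace (𝓡∂ (m + 1)) x [⋀^Fin k]→L[ℝ] ℝ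

abbrev VField (m : ℕ) (M : Type*) [TopologicalSpace M]
    [ChartedSpace (EuclideanHalfSpace (m + 1)) M] :=
  (x : M) → TangentSpace (𝓡∂ (m + 1)) x

instance (x : M) : FiniteDimensional ℝ (TangentSpace (𝓡∂ (m + 1)) x) :=
  inferInstanceAs (FiniteDimensional ℝ (EuclideanSpace ℝ (Fin (m + 1))))

instance (x : M) : Fact (finrank ℝ (TangentSpace (𝓡∂ (m + 1)) x) = m + 1) :=
  ⟨finrank_euclideanSpace_fin (𝕜 := ℝ) (n := m + 1)⟩

instance (x : M) : T2Space (TangentSpace (𝓡∂ (m + 1)) x) :=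
  inferInstanceAs (T2Space (EuclideanSpace ℝ (Fin (m + 1))))

/-- The derivative at `y` of the inverse of the chart at `i`. -/
def dChartSymm (i : M) (y : EuclideanSpace ℝ (Fin (m + 1))) :
    EuclideanSpace ℝ (Fin (m + 1)) →L[ℝ]
      TangentSpace (𝓡∂ (m + 1)) ((extChartAt (𝓡∂ (m + 1)) i).symm y) :=
  mfderivWithin 𝓘(ℝ, EuclideanSpace ℝ (Fin (m + 1))) (𝓡∂ (m + 1))
    (extChartAt (𝓡∂ (m + 1)) i).symm (range (𝓡∂ (m + 1))) y

/-- The derivative at `x` of the chart at `i`. -/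
def dChart (i x : M) :
    TangentSpace (𝓡∂ (m + 1)) x →L[ℝ] EuclideanSpace ℝ (Fin (m + 1)) :=
  mfderiv (𝓡∂ (m + 1)) 𝓘(ℝ, EuclideanSpace ℝ (Fin (m + 1))) (extChartAt (𝓡∂ (m + 1)) i) x

/-- The coordinate expression of a form in the chart at `i`: its pullback under the inverse
chart, meaningful on the target of the chart. -/
def inChart {k : ℕ} (β : DForm m M k) (i : M) (y : EuclideanSpace ℝ (Fin (m + 1))) :
    EuclideanSpace ℝ (Fin (m + 1)) [⋀^Fin k]→L[ℝ] ℝ :=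
  (β ((extChartAt (𝓡∂ (m + 1)) i).symm y)).compContinuousLinearMap (dChartSymm i y)

/-- The coordinate expression of a vector field in the chart at `i`. -/
def vInChart (v : VField m M) (i : M) (y : EuclideanSpace ℝ (Fin (m + 1))) :
    EuclideanSpace ℝ (Fin (m + 1)) :=
  dChart i ((extChartAt (𝓡∂ (m + 1)) i).symm y) (v ((extChartAt (𝓡∂ (m + 1)) i).symm y))

/-- Smooth forms: `Ω^k(M)`. -/
def IsSmooth {k : ℕ} (β : DForm m M k) : Prop :=
  ∀ i : M, ContDiffOn ℝ ∞ (inChart β i) (extChartAt (𝓡∂ (m + 1)) i).target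

def wedge {k l r : ℕ} (h : k + l = r) (α : DForm m M k) (β : DForm m M l) : DForm m M r :=
  fun x => wedgeAt h (α x) (β x)

/-- The product of a function (a `0`-form) and a form. -/
def fsmul {k : ℕ} (f : DForm m M 0) (β : DForm m M k) : DForm m M k :=
  fun x => f x Fin.elim0 • β x

/-- The exterior derivative, computed at `x` in the chart at `x`. -/
def extD {k : ℕ} (β : DForm m M k) : DForm m M (k + 1) := fun x =>
  (extDerivWithin (inChart β x) (range (𝓡∂ (m + 1)))
    (extChartAt (𝓡∂ (m + 1)) x x)).compContinuousLinearMap (dChart x x)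

/-- The Lie derivative of a form `β` along a vector field `v`, computed at `x` in the chart at
`x`. In coordinates it is `w ↦ (D β · v) (w) + ∑ j, β (w 0, …, D v · w j, …, w (k - 1))`. -/
def lieD {k : ℕ} (v : VField m M) (β : DForm m M k) : DForm m M k := fun x =>
  (fderivWithin ℝ (inChart β x) (range (𝓡∂ (m + 1))) (extChartAt (𝓡∂ (m + 1)) x x)
      (vInChart v x (extChartAt (𝓡∂ (m + 1)) x x)) +
    derivAct (fderivWithin ℝ (vInChart v x) (range (𝓡∂ (m + 1)))
        (extChartAt (𝓡∂ (m + 1)) x x)).toLinearMap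
      (inChart β x (extChartAt (𝓡∂ (m + 1)) x x))).compContinuousLinearMap (dChart x x)

/-! ### Orientation, volume form, Hodge star -/

variable [RiemannianBundle (fun x : M => TangentSpace (𝓡∂ (m + 1)) x)]

/-- The Riemannian volume form of a pointwise choice of orientations: it takes the value `1` on
positively oriented orthonormal bases. -/
def volOf (o : (x : M) → Orientation ℝ (TangentSpace (𝓡∂ (m + 1)) x) (Fin (m + 1))) :
    DForm m M (m + 1) :=
  fun x => toCont ((o x).volumeForm)

/-- `1` or `-1` according to whether the coordinate frame of the chart at `i` is positively or
negatively oriented at the point with coordinates `y`. -/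
def chartSign (o : (x : M) → Orientation ℝ (TangentSpace (𝓡∂ (m + 1)) x) (Fin (m + 1)))
    (i : M) (y : EuclideanSpace ℝ (Fin (m + 1))) : ℝ :=
  (SignType.sign (inChart (volOf o) i y (fun j => EuclideanSpace.single j 1)) : ℝ)

end Forms

/-- An orientation of `M`: a choice of orientations of the tangent spaces for which the
orientation of the coordinate frame of each chart is locally constant. -/
structure ManifoldOrientation (m : ℕ) (M : Type*) [TopologicalSpace M]
    [ChartedSpace (EuclideanHalfSpace (m + 1)) M]
    [RiemannianBundle (fun x : M => TangentSpace (𝓡∂ (m + 1)) x)] where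
  orient : (x : M) → Orientation ℝ (TangentSpace (𝓡∂ (m + 1)) x) (Fin (m + 1))
  continuousOn_sign : ∀ i : M,
    ContinuousOn (chartSign orient i) (extChartAt (𝓡∂ (m + 1)) i).target

section Riemannian

variable {m : ℕ} {M : Type*} [TopologicalSpace M] [ChartedSpace (EuclideanHalfSpace (m + 1)) M]
  [RiemannianBundle (fun x : M => TangentSpace (𝓡∂ (m + 1)) x)]

/-- The Riemannian volume form. -/
def vol (o : ManifoldOrientation m M) : DForm m M (m + 1) := volOf o.orient

/-- The Hodge star on `k`-forms: with an orthonormal basis `e`,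
`(⋆ α) (v) = ∑_{f 0 < ⋯ < f (k - 1)} α (e_{f 0}, …) * vol (e_{f 0}, …, e_{f (k - 1)}, v)`,
where the sum over increasing `f` is written as `1 / k!` times the sum over all `f`.
Equivalently, `β ∧ ⋆ α = ⟨β, α⟩ vol` for all `k`-forms `β`. -/
def star {k l : ℕ} (h : l + k = m + 1) (o : ManifoldOrientation m M) (α : DForm m M k) :
    DForm m M l := fun x =>
  ((k.factorial : ℝ)⁻¹) • ∑ f : Fin k → Fin (finrank ℝ (TangentSpace (𝓡∂ (m + 1)) x)),
    α x (fun i => stdOrthonormalBasis ℝ (TangentSpace (𝓡∂ (m + 1)) x) (f i)) •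
      contractFirst k
        (toCont ((vol o x).toAlternatingMap.domDomCongr (finCongr h.symm)))
        (fun i => stdOrthonormalBasis ℝ (TangentSpace (𝓡∂ (m + 1)) x) (f i))

/-- The vector field `ω̂` of an `m`-form `ω`: the unique one with `ι_ω̂ vol = ω`. -/
def hat (o : ManifoldOrientation m M) (w : DForm m M m) : VField m M := fun x =>
  Function.invFun
    (fun v : TangentSpace (𝓡∂ (m + 1)) x => interiorAt v (vol o x)) (w x)

/-- The interconnection map `φ̃_a : ω ↦ L_ω̂ a`. -/
def interconnection {l : ℕ} (o : ManifoldOrientation m M) (a : DForm m M l) (w : DForm m M m) :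
    DForm m M l :=
  lieD (hat o w) a

/-! ### Integration over `M` and over its boundary -/

/-- The inclusion `y ↦ (0, y)` of the boundary hyperplane of the half-space. -/
def bdryIncl (m : ℕ) : EuclideanSpace ℝ (Fin m) →L[ℝ] EuclideanSpace ℝ (Fin (m + 1)) :=
  LinearMap.toContinuousLinearMap
    { toFun := fun y => WithLp.toLp 2 (Fin.cons 0 (fun j => y j))
      map_add' := by
        intro y z
        ext j
        refine Fin.cases ?_ (fun j => ?_) j <;> simp
      map_smul' := by
        intro c y
        ext j
        refine Fin.cases ?_ (fun j => ?_) j <;> simp }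

/-- Orientation of the boundary in the boundary chart induced by the chart at `i`, outward normal
first: the sign of the frame `(-∂_0, ∂_1, …, ∂_m)`, `-∂_0` being outward pointing. -/
def bdrySign (o : ManifoldOrientation m M) (i : M) (y : EuclideanSpace ℝ (Fin m)) : ℝ :=
  (SignType.sign (inChart (vol o) i (bdryIncl m y)
    (Fin.cons (-EuclideanSpace.single 0 1)
      (fun j => bdryIncl m (EuclideanSpace.single j 1)))) : ℝ)

/-- The trace of a form on the boundary (its pullback under the inclusion of the boundary), in the
boundary chart `y ↦ (chart at i)⁻¹ (0, y)`. -/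
def traceInChart {k : ℕ} (η : DForm m M k) (i : M) (y : EuclideanSpace ℝ (Fin m)) :
    EuclideanSpace ℝ (Fin m) [⋀^Fin k]→L[ℝ] ℝ :=
  (inChart η i (bdryIncl m y)).compContinuousLinearMap (bdryIncl m)

variable [IsManifold (𝓡∂ (m + 1)) ∞ M] [CompactSpace M] [T2Space M]

/-- A smooth partition of unity subordinate to the cover of `M` by the domains of its charts. -/
def chartPOU (m : ℕ) (M : Type*) [TopologicalSpace M]
    [ChartedSpace (EuclideanHalfSpace (m + 1)) M]
    [IsManifold (𝓡∂ (m + 1)) ∞ M] [CompactSpace M] [T2Space M] :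
    SmoothPartitionOfUnity M (𝓡∂ (m + 1)) M univ :=
  Classical.choose (SmoothPartitionOfUnity.exists_isSubordinate_chartAt_source (𝓡∂ (m + 1)) M)

/-- The integral of a top form over the oriented manifold `M`. -/
def integralM (o : ManifoldOrientation m M) (β : DForm m M (m + 1)) : ℝ :=
  ∑ᶠ i : M, ∫ y in (extChartAt (𝓡∂ (m + 1)) i).target,
    chartSign o.orient i y * chartPOU m M i ((extChartAt (𝓡∂ (m + 1)) i).symm y) *
      inChart β i y (fun j => EuclideanSpace.single j 1)

/-- The integral of the trace of an `m`-form over the boundary of `M`, which carries the boundary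
orientation. -/
def integralBdry (o : ManifoldOrientation m M) (η : DForm m M m) : ℝ :=
  ∑ᶠ i : M, ∫ y in {y | bdryIncl m y ∈ (extChartAt (𝓡∂ (m + 1)) i).target},
    bdrySign o i y * chartPOU m M i ((extChartAt (𝓡∂ (m + 1)) i).symm (bdryIncl m y)) *
      traceInChart η i y (fun j => EuclideanSpace.single j 1)

/-- The duality pairing `⟨α | β⟩ = ∫_M α ∧ β` of forms of complementary degrees. -/
def pairing {k l : ℕ} (h : k + l = m + 1) (o : ManifoldOrientation m M)
    (α : DForm m M k) (β : DForm m M l) : ℝ :=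
  integralM o (wedge h α β)

/-- `ψ : Ω^k(M) → Ω^1(M)` is a formal dual of `φ : Ω^m(M) → Ω^l(M)`, `k + l = dim M`:
`⟨ψ ā | ω⟩ = ⟨ā | φ ω⟩` for all `ω` supported in the interior of `M`. -/
def IsFormalDual {k l : ℕ} (h : k + l = m + 1) (o : ManifoldOrientation m M)
    (φ : DForm m M m → DForm m M l) (ψ : DForm m M k → DForm m M 1) : Prop :=
  ∀ abar : DForm m M k, IsSmooth abar → IsSmooth (ψ abar) ∧
    ∀ w : DForm m M m, IsSmooth w →
      closure {x : M | w x ≠ 0} ⊆ (𝓡∂ (m + 1)).interior M →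
      pairing (Nat.add_comm 1 m) o (ψ abar) w = pairing h o abar (φ w)

/-- `η` is a surface term for `φ` and `ψ`: for all `ω`, `ā`, the form `η ω ā` is in `Ω^m(M)` and
`⟨ψ ā | ω⟩ = ⟨ā | φ ω⟩ + ∫_∂M η ω ā`. -/
def HasSurfaceTerm {k l : ℕ} (h : k + l = m + 1) (o : ManifoldOrientation m M)
    (φ : DForm m M m → DForm m M l) (ψ : DForm m M k → DForm m M 1)
    (η : DForm m M m → DForm m M k → DForm m M m) : Prop :=
  ∀ (w : DForm m M m) (abar : DForm m M k), IsSmooth w → IsSmooth abar →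
    IsSmooth (η w abar) ∧
    pairing (Nat.add_comm 1 m) o (ψ abar) w =
      pairing h o abar (φ w) + integralBdry o (η w abar)

end Riemannian

end FluidForms

end

noncomputable section

namespace FluidForms

/-! Let `μ` be the volume form, `v` the field of `ω`, so that `ω = ι_v μ`. Everything rests on the
pointwise identity `α ∧ ι_v μ = α(v) μ` for 1-forms (`wedgeAt_interiorAt`), which turns each pairing
with `Ω^1` into the integral of the density `α(v)`.

If `a` is a function, then `L_v a = da(v)`, and `ā = (*ā) μ` by `density_star`. The integrands `(*ā)
da ∧ ω` and `ā ∧ L_v a` are then the same form, and no integration by parts takes place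
(`pairing_lieD_zero`).

If `a = f μ` with `f = *a`, then in a chart where `a` has coefficient `A` and `v` has components
`X`, the coefficient of `L_v a` is `div (A X)` (`topCoef_lieD`). By Leibniz, the difference of the
integrands `-f dā ∧ ω` and `ā L_v a` is the divergence density of the field `-ā f v`. The divergence
theorem `sum_integral_div` gives its flux, the integral of the trace of `ι_{-ā f v} μ = -f ω ∧ ā`,
which is the surface term (`pairing_lieD_top`).

The divergence theorem is proved from the half-space (`integral_divCoord_halfSpace`): the field is
localized by the partition of unity in each chart, and the extra terms `dρ_i(v)` cancel in the sum
(`sum_integral_dAlong`) because integrals do not depend on the chart (`integral_target_eq`). Since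
`lieD` and `extD` are computed at each point in that point's own chart, their formulas must first be
shown invariant under coordinate changes (`lieCoord_pullback`, `inChart_extD_zero`).

For uniqueness, let `γ` be the difference of two candidate values. Testing against `ω = ι_v μ` with
`v = χ grad γ`, `χ` a bump function supported in the interior, integrates a nonnegative density that
would be positive where `γ ≠ 0`. So `γ` vanishes in the interior, and on the boundary by continuity
(`eq_of_pairing_eq`). -/

/-- A top form is determined by its value on a basis. -/
theorem topForm_ext {T : Type*} [AddCommGroup T] [Module ℝ T] [TopologicalSpace T] {n : ℕ}
    (b : Basis (Fin n) ℝ T) {α β : T [⋀^Fin n]→L[ℝ] ℝ}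
    (h : α b = β b) : α = β := by
  have h1 := α.toAlternatingMap.eq_smul_basis_det b
  have h2 := β.toAlternatingMap.eq_smul_basis_det b
  have : α.toAlternatingMap = β.toAlternatingMap := by
    rw [h1, h2]
    exact congrArg (· • b.det) h
  ext v
  exact congrArg (fun f => f v) this

/-- An injective `m`-tuple of indices in `Fin (m + 1)` misses some `j`, so it is a permutation of
`j.succAbove`. This embeds the `m`-forms in a space of dimension `m + 1`. -/
theorem eq_zero_of_forall_succAbove {T : Type*} [AddCommGroup T] [Module ℝ T] {m : ℕ}
    (b : Basis (Fin (m + 1)) ℝ T)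
    {w : T [⋀^Fin m]→ₗ[ℝ] ℝ} (hw : ∀ j : Fin (m + 1), w (fun i => b (j.succAbove i)) = 0) :
    w = 0 := by
  refine b.ext_alternating fun r hr => ?_
  obtain ⟨j, hj⟩ : ∃ j, ∀ i, r i ≠ j := by
    by_contra! hcon
    have := Fintype.card_le_of_surjective r hcon
    simp at this
  choose ρ hρ using fun i => Fin.exists_succAbove_eq (hj i)
  have hinj : Function.Injective ρ := fun i i' h => hr (by rw [← hρ, ← hρ, h])
  let τ : Equiv.Perm (Fin m) := Equiv.ofBijective ρ (Finite.injective_iff_bijective.1 hinj)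
  have h1 : (fun i => b (r i)) = (fun i => b (j.succAbove i)) ∘ τ := by
    funext i
    simp [τ, hρ]
  rw [h1, w.map_perm, hw j]
  simp

/-! ### Wedge and interior products with top forms -/

section Algebra

variable {T : Type*} [AddCommGroup T] [Module ℝ T] [TopologicalSpace T]
  [IsTopologicalAddGroup T] [ContinuousSMul ℝ T] [T2Space T] [FiniteDimensional ℝ T]

@[simp]
theorem toCont_apply {k : ℕ} (f : T [⋀^Fin k]→ₗ[ℝ] ℝ) (v : Fin k → T) : toCont f v = f v := rfl

theorem interiorAt_apply {k : ℕ} (v : T) (α : T [⋀^Fin (k + 1)]→L[ℝ] ℝ) (w : Fin k → T) :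
    interiorAt v α w = α (Fin.cons v w) := rfl

/-- The wedge product as a sum over all permutations. -/
theorem factorial_mul_wedgeAt_apply {k l r : ℕ} (h : k + l = r) (α : T [⋀^Fin k]→L[ℝ] ℝ)
    (β : T [⋀^Fin l]→L[ℝ] ℝ) (v : Fin r → T) :
    ((k.factorial * l.factorial : ℕ) : ℝ) * wedgeAt h α β v =
      ∑ σ : Equiv.Perm (Fin k ⊕ Fin l), ((Equiv.Perm.sign σ : ℤ) : ℝ) *
        (α (fun i => v (finCongr h (finSumFinEquiv (σ (Sum.inl i))))) *
          β (fun i => v (finCongr h (finSumFinEquiv (σ (Sum.inr i)))))) := by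
  -- Antisymmetrizing the plain product over all permutations counts each shuffle `k! l!` times.
  have key := congrArg (fun f => LinearMap.mul' ℝ ℝ
      (f (fun i => v (finCongr h (finSumFinEquiv i)))))
    (MultilinearMap.domCoprod_alternization_eq α.toAlternatingMap β.toAlternatingMap)
  simp only [Fintype.card_fin, MultilinearMap.alternatization_apply, map_sum] at key
  have h2 : LinearMap.mul' ℝ ℝ (((k.factorial * l.factorial) •
      α.toAlternatingMap.domCoprod β.toAlternatingMap)
        (fun i => v (finCongr h (finSumFinEquiv i)))) =
      ((k.factorial * l.factorial : ℕ) : ℝ) * wedgeAt h α β v := by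
    rw [AlternatingMap.smul_apply, map_nsmul, nsmul_eq_mul]
    rfl
  rw [← h2, ← key]
  refine Finset.sum_congr rfl fun σ _ => ?_
  rw [Units.smul_def, map_zsmul, zsmul_eq_mul]
  rfl

/-- Only `β` has arguments to permute: the sign of each permutation cancels against the sign `β`
acquires, so all `l!` terms are equal. -/
theorem wedgeAt_zero_left {l : ℕ} (h : 0 + l = l) (f : T [⋀^Fin 0]→L[ℝ] ℝ)
    (β : T [⋀^Fin l]→L[ℝ] ℝ) : wedgeAt h f β = f Fin.elim0 • β := by
  ext v
  have key := factorial_mul_wedgeAt_apply h f β v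
  have hl : ((Nat.factorial 0 * l.factorial : ℕ) : ℝ) ≠ 0 := by positivity
  apply mul_left_cancel₀ hl
  rw [key]
  have hterm : ∀ σ : Equiv.Perm (Fin 0 ⊕ Fin l), ((Equiv.Perm.sign σ : ℤ) : ℝ) *
        (f (fun i => v (finCongr h (finSumFinEquiv (σ (Sum.inl i))))) *
          β (fun i => v (finCongr h (finSumFinEquiv (σ (Sum.inr i)))))) =
        f Fin.elim0 * β v := by
    intro σ
    let e : Fin 0 ⊕ Fin l ≃ Fin l := finSumFinEquiv.trans (finCongr h)
    let τ : Equiv.Perm (Fin l) := (e.symm.trans σ).trans e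
    have he : ∀ i, e (Sum.inr i) = i := fun i => by ext; simp [e]
    have he' : ∀ i, e.symm i = Sum.inr i := fun i => by rw [Equiv.symm_apply_eq, he]
    have h1 : (fun i => v (finCongr h (finSumFinEquiv (σ (Sum.inr i))))) = v ∘ τ := by
      funext i
      simp only [Function.comp, τ, Equiv.trans_apply, he']
      rfl
    have hs : Equiv.Perm.sign τ = Equiv.Perm.sign σ := Equiv.Perm.sign_symm_trans_trans σ e
    have h2 := β.toAlternatingMap.map_perm v τ
    have h3 : (fun i => v (finCongr h (finSumFinEquiv (σ (Sum.inl i))))) = Fin.elim0 :=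
      Subsingleton.elim _ _
    rw [h1, h3]
    change _ * (_ * β.toAlternatingMap _) = _ * β.toAlternatingMap v
    rw [h2, hs, Units.smul_def, zsmul_eq_mul]
    rcases Int.units_eq_one_or (Equiv.Perm.sign σ) with hh | hh <;> rw [hh] <;> push_cast <;> ring
  rw [Finset.sum_congr rfl fun σ _ => hterm σ, Finset.sum_const, Finset.card_univ,
    Fintype.card_perm, nsmul_eq_mul]
  simp

theorem wedgeAt_zero_right {k : ℕ} (h : k + 0 = k) (α : T [⋀^Fin k]→L[ℝ] ℝ)
    (f : T [⋀^Fin 0]→L[ℝ] ℝ) : wedgeAt h α f = f Fin.elim0 • α := by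
  ext v
  have key := factorial_mul_wedgeAt_apply h α f v
  have hl : ((k.factorial * Nat.factorial 0 : ℕ) : ℝ) ≠ 0 := by positivity
  apply mul_left_cancel₀ hl
  rw [key]
  have hterm : ∀ σ : Equiv.Perm (Fin k ⊕ Fin 0), ((Equiv.Perm.sign σ : ℤ) : ℝ) *
        (α (fun i => v (finCongr h (finSumFinEquiv (σ (Sum.inl i))))) *
          f (fun i => v (finCongr h (finSumFinEquiv (σ (Sum.inr i)))))) =
        f Fin.elim0 * α v := by
    intro σ
    let e : Fin k ⊕ Fin 0 ≃ Fin k := finSumFinEquiv.trans (finCongr h)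
    let τ : Equiv.Perm (Fin k) := (e.symm.trans σ).trans e
    have he : ∀ i, e (Sum.inl i) = i := fun i => by ext; rfl
    have he' : ∀ i, e.symm i = Sum.inl i := fun i => by rw [Equiv.symm_apply_eq, he]
    have h1 : (fun i => v (finCongr h (finSumFinEquiv (σ (Sum.inl i))))) = v ∘ τ := by
      funext i
      simp only [Function.comp, τ, Equiv.trans_apply, he']
      rfl
    have hs : Equiv.Perm.sign τ = Equiv.Perm.sign σ := Equiv.Perm.sign_symm_trans_trans σ e
    have h2 := α.toAlternatingMap.map_perm v τ
    have h3 : (fun i => v (finCongr h (finSumFinEquiv (σ (Sum.inr i))))) = Fin.elim0 :=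
      Subsingleton.elim _ _
    rw [h1, h3]
    change _ * (α.toAlternatingMap _ * _) = _ * α.toAlternatingMap v
    rw [h2, hs, Units.smul_def, zsmul_eq_mul]
    rcases Int.units_eq_one_or (Equiv.Perm.sign σ) with hh | hh <;> rw [hh] <;> push_cast <;> ring
  rw [Finset.sum_congr rfl fun σ _ => hterm σ, Finset.sum_const, Finset.card_univ,
    Fintype.card_perm, nsmul_eq_mul]
  simp

theorem wedgeAt_add_right {k l r : ℕ} (h : k + l = r) (α : T [⋀^Fin k]→L[ℝ] ℝ)
    (β γ : T [⋀^Fin l]→L[ℝ] ℝ) : wedgeAt h α (β + γ) = wedgeAt h α β + wedgeAt h α γ := by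
  ext v
  have hl : ((k.factorial * l.factorial : ℕ) : ℝ) ≠ 0 := by positivity
  apply mul_left_cancel₀ hl
  rw [ContinuousAlternatingMap.add_apply, mul_add, factorial_mul_wedgeAt_apply,
    factorial_mul_wedgeAt_apply, factorial_mul_wedgeAt_apply, ← Finset.sum_add_distrib]
  refine Finset.sum_congr rfl fun σ _ => ?_
  rw [ContinuousAlternatingMap.add_apply]
  ring

theorem wedgeAt_smul_right {k l r : ℕ} (h : k + l = r) (α : T [⋀^Fin k]→L[ℝ] ℝ) (c : ℝ)
    (β : T [⋀^Fin l]→L[ℝ] ℝ) : wedgeAt h α (c • β) = c • wedgeAt h α β := by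
  ext v
  have hl : ((k.factorial * l.factorial : ℕ) : ℝ) ≠ 0 := by positivity
  apply mul_left_cancel₀ hl
  rw [ContinuousAlternatingMap.smul_apply, smul_eq_mul, mul_left_comm, factorial_mul_wedgeAt_apply,
    factorial_mul_wedgeAt_apply, Finset.mul_sum]
  refine Finset.sum_congr rfl fun σ _ => ?_
  rw [ContinuousAlternatingMap.smul_apply, smul_eq_mul]
  ring

theorem interiorAt_add {k : ℕ} (v w : T) (α : T [⋀^Fin (k + 1)]→L[ℝ] ℝ) :
    interiorAt (v + w) α = interiorAt v α + interiorAt w α := by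
  ext u
  exact congrArg (fun f => f u) (α.toAlternatingMap.curryLeft.map_add v w)

theorem interiorAt_smul {k : ℕ} (c : ℝ) (v : T) (α : T [⋀^Fin (k + 1)]→L[ℝ] ℝ) :
    interiorAt (c • v) α = c • interiorAt v α := by
  ext u
  exact congrArg (fun f => f u) (α.toAlternatingMap.curryLeft.map_smul c v)

/-- A permutation `τ` with `τ 0 ≠ j` feeds `b j` twice to `μ` and contributes nothing. The `m!`
others contribute equally, which cancels the factor `1! m!`. -/
theorem wedgeAt_interiorAt_basis {m : ℕ} (h : 1 + m = m + 1) (b : Basis (Fin (m + 1)) ℝ T)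
    (α : T [⋀^Fin 1]→L[ℝ] ℝ) (μ : T [⋀^Fin (m + 1)]→L[ℝ] ℝ) (j : Fin (m + 1)) :
    wedgeAt h α (interiorAt (b j) μ) b = α (fun _ => b j) * μ b := by
  have key := factorial_mul_wedgeAt_apply h α (interiorAt (b j) μ) b
  let e : Fin 1 ⊕ Fin m ≃ Fin (m + 1) := finSumFinEquiv.trans (finCongr h)
  have he0 : e (Sum.inl 0) = 0 := by ext; simp [e]
  have he1 : ∀ i, e (Sum.inr i) = i.succ := fun i => by ext; simp [e]
  have hl : ((Nat.factorial 1 * m.factorial : ℕ) : ℝ) ≠ 0 := by positivity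
  apply mul_left_cancel₀ hl
  rw [key]
  let G : Equiv.Perm (Fin (m + 1)) → ℝ := fun τ => ((Equiv.Perm.sign τ : ℤ) : ℝ) *
    (α (fun _ => b (τ 0)) * μ (Fin.cons (b j) (fun i => b (τ i.succ))))
  have hsum : ∑ σ : Equiv.Perm (Fin 1 ⊕ Fin m), ((Equiv.Perm.sign σ : ℤ) : ℝ) *
        (α (fun i => b (finCongr h (finSumFinEquiv (σ (Sum.inl i))))) *
          interiorAt (b j) μ (fun i => b (finCongr h (finSumFinEquiv (σ (Sum.inr i)))))) =
      ∑ τ, G τ := by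
    refine Fintype.sum_equiv (e.permCongr) _ _ fun σ => ?_
    have hsym0 : e.symm 0 = Sum.inl 0 := by rw [Equiv.symm_apply_eq, he0]
    have hsym1 : ∀ i : Fin m, e.symm i.succ = Sum.inr i := fun i => by
      rw [Equiv.symm_apply_eq, he1]
    simp only [G, Equiv.Perm.sign_permCongr, interiorAt_apply, Equiv.permCongr_apply, hsym0, hsym1]
    congr 3
    funext i
    rw [Subsingleton.elim i 0]
    rfl
  rw [hsum]
  have hG : ∀ τ : Equiv.Perm (Fin (m + 1)), G τ =
      if τ 0 = j then α (fun _ => b j) * μ b else 0 := by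
    intro τ
    split_ifs with hτ
    · have h1 : (Fin.cons (b j) (fun i => b (τ i.succ)) : Fin (m + 1) → T) = b ∘ τ := by
        funext i
        refine Fin.cases ?_ (fun i => ?_) i
        · simp [hτ]
        · simp
      have h2 := μ.toAlternatingMap.map_perm b τ
      simp only [G, hτ, h1]
      change _ * (_ * μ.toAlternatingMap _) = _ * μ.toAlternatingMap b
      rw [h2, Units.smul_def, zsmul_eq_mul]
      rcases Int.units_eq_one_or (Equiv.Perm.sign τ) with hh | hh <;> rw [hh] <;> push_cast <;> ring
    · have hne : τ.symm j ≠ 0 := fun h0 => hτ (by rw [← h0, Equiv.apply_symm_apply])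
      obtain ⟨i, hi⟩ := Fin.exists_succ_eq.2 hne
      have : μ (Fin.cons (b j) (fun i => b (τ i.succ))) = 0 := by
        refine μ.map_eq_zero_of_eq _ (i := 0) (j := i.succ) ?_ (Fin.succ_ne_zero i).symm
        rw [Fin.cons_zero, Fin.cons_succ, hi, Equiv.apply_symm_apply]
      simp only [G, this, mul_zero]
  -- `decomposeFin` splits `τ` into the value `τ 0` and a permutation of `Fin m`, whence the count
  -- `m!`.
  rw [Finset.sum_congr rfl fun τ _ => hG τ,
    ← Equiv.sum_comp (Equiv.Perm.decomposeFin (n := m)).symm, Fintype.sum_prod_type]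
  simp only [Equiv.Perm.decomposeFin_symm_apply_zero, Finset.sum_const, Finset.card_univ,
    Fintype.card_perm, Fintype.card_fin, nsmul_eq_mul, mul_ite, mul_zero, Finset.sum_ite_eq',
    Finset.mem_univ, if_true]
  simp

/-- Both sides are top forms and linear in `v`, so it suffices to take `v` in a basis and to
evaluate on that basis. -/
theorem wedgeAt_interiorAt {m : ℕ} (h : 1 + m = m + 1) (hT : finrank ℝ T = m + 1)
    (α : T [⋀^Fin 1]→L[ℝ] ℝ) (μ : T [⋀^Fin (m + 1)]→L[ℝ] ℝ) (v : T) :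
    wedgeAt h α (interiorAt v μ) = α (fun _ => v) • μ := by
  let b : Basis (Fin (m + 1)) ℝ T := finBasisOfFinrankEq ℝ T hT
  refine topForm_ext b ?_
  let A : T →ₗ[ℝ] ℝ :=
    { toFun := fun v => wedgeAt h α (interiorAt v μ) b
      map_add' := fun v w => by rw [interiorAt_add, wedgeAt_add_right]; rfl
      map_smul' := fun c v => by rw [interiorAt_smul, wedgeAt_smul_right]; rfl }
  let a : T →ₗ[ℝ] ℝ :=
    (ContinuousAlternatingMap.ofSubsingleton ℝ T ℝ (0 : Fin 1)).symm α
  have ha : ∀ v, a v = α (fun _ => v) := fun v => rfl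
  have hAB : A = (μ b) • a := by
    refine b.ext fun j => ?_
    rw [LinearMap.smul_apply, ha, smul_eq_mul, mul_comm]
    exact wedgeAt_interiorAt_basis h b α μ j
  have := congrArg (fun f => f v) hAB
  simp only [LinearMap.smul_apply, ha, smul_eq_mul] at this
  rw [ContinuousAlternatingMap.smul_apply, smul_eq_mul, mul_comm, ← this]
  rfl

theorem contractFirst_zero_apply (k : ℕ) (α : T [⋀^Fin (0 + k)]→L[ℝ] ℝ) (w : Fin k → T) :
    contractFirst k α w Fin.elim0 = α (fun i => w (Fin.cast (Nat.zero_add k) i)) := by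
  induction k with
  | zero => exact congrArg α (funext fun i => i.elim0)
  | succ k ih =>
    change contractFirst k (interiorAt (w 0) α) (fun i => w i.succ) Fin.elim0 = _
    rw [ih, interiorAt_apply]
    congr 1
    funext i
    refine Fin.cases ?_ (fun i => ?_) i <;> rfl

/-- Contraction with a nonzero top form is injective. -/
theorem interiorAt_injective {m : ℕ} (hT : finrank ℝ T = m + 1)
    {μ : T [⋀^Fin (m + 1)]→L[ℝ] ℝ} (hμ : μ ≠ 0) :
    Function.Injective (fun v : T => interiorAt v μ) := by
  intro v v' hv
  let b : Basis (Fin (m + 1)) ℝ T := finBasisOfFinrankEq ℝ T hT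
  refine b.ext_elem fun j => ?_
  -- Wedging `ι_v μ` with the dual basis form `b.coord j` gives the `j`-th coordinate of `v` times
  -- `μ`.
  let α : T [⋀^Fin 1]→L[ℝ] ℝ := ContinuousAlternatingMap.ofSubsingleton ℝ T ℝ (0 : Fin 1)
    (LinearMap.toContinuousLinearMap (b.coord j))
  have h1 := wedgeAt_interiorAt (Nat.add_comm 1 m) hT α μ v
  have h2 := wedgeAt_interiorAt (Nat.add_comm 1 m) hT α μ v'
  rw [show interiorAt v μ = interiorAt v' μ from hv, h2] at h1
  exact (smul_left_injective ℝ hμ h1).symm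

/-- Contraction with a nonzero top form is onto. -/
theorem interiorAt_surjective {m : ℕ} (hT : finrank ℝ T = m + 1)
    {μ : T [⋀^Fin (m + 1)]→L[ℝ] ℝ} (hμ : μ ≠ 0) :
    Function.Surjective (fun v : T => interiorAt v μ) := by
  let b : Basis (Fin (m + 1)) ℝ T := finBasisOfFinrankEq ℝ T hT
  -- Dimension count: `R` is injective, and so is its composite `C` with contraction. As `C` maps
  -- between spaces of dimension `m + 1`, it is onto; injectivity of `R` then carries the preimage
  -- back to `w`.
  let R : (T [⋀^Fin m]→ₗ[ℝ] ℝ) →ₗ[ℝ] (Fin (m + 1) → ℝ) :=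
    { toFun := fun w j => w (fun i => b (j.succAbove i))
      map_add' := fun _ _ => rfl
      map_smul' := fun _ _ => rfl }
  have hR : Function.Injective R := by
    rw [← LinearMap.ker_eq_bot, LinearMap.ker_eq_bot']
    exact fun w hw => eq_zero_of_forall_succAbove b fun j => congrFun hw j
  let C : T →ₗ[ℝ] (Fin (m + 1) → ℝ) := R ∘ₗ μ.toAlternatingMap.curryLeft
  have hC : Function.Injective C := by
    intro v v' hv
    refine interiorAt_injective hT hμ ?_
    ext u
    exact congrArg (fun f => f u) (hR (a₁ := μ.toAlternatingMap.curryLeft v)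
      (a₂ := μ.toAlternatingMap.curryLeft v') hv)
  have hCs : Function.Surjective C :=
    (LinearMap.injective_iff_surjective_of_finrank_eq_finrank (by simp [hT])).1 hC
  intro w
  obtain ⟨v, hv⟩ := hCs (R w.toAlternatingMap)
  refine ⟨v, ?_⟩
  ext u
  exact congrArg (fun f => f u) (hR (a₁ := μ.toAlternatingMap.curryLeft v) hv)

end Algebra

/-! ### Volume forms of inner product spaces -/

section InnerProduct

variable {T : Type*} [NormedAddCommGroup T] [InnerProductSpace ℝ T]

/-- Up to sign the volume form is a determinant in an orthonormal basis, and `det A ^ 2 = det (Aᵀ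
A)`. The square no longer sees the orientation, so smoothness of the metric can pass to the volume
form. -/
theorem volumeForm_sq {n : ℕ} [Fact (finrank ℝ T = n)] (o : Orientation ℝ T (Fin n))
    (b : OrthonormalBasis (Fin n) ℝ T) (v : Fin n → T) :
    o.volumeForm v ^ 2 = (Matrix.of fun i j => inner ℝ (v i) (v j)).det := by
  rw [← sq_abs, o.volumeForm_robust' b, sq_abs, Basis.det_apply, sq]
  conv_lhs => enter [1]; rw [← Matrix.det_transpose]
  rw [← Matrix.det_mul]
  congr 1
  ext i j
  rw [Matrix.mul_apply, Matrix.of_apply, ← b.sum_inner_mul_inner]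
  refine Finset.sum_congr rfl fun k _ => ?_
  simp [Basis.toMatrix_apply, b.repr_apply_apply, real_inner_comm]

/-- Non-injective choices repeat a vector and give `0`; the `n!` permutations give `1` each. This
cancels the `1 / k!` in `star`. `N` is separate from `n` because the standard orthonormal basis is
indexed by `Fin (finrank ℝ T)`, which is `Fin n` only propositionally. -/
theorem sum_volumeForm_sq {n : ℕ} [Fact (finrank ℝ T = n)] (o : Orientation ℝ T (Fin n))
    {N : ℕ} (hN : N = n) (b : OrthonormalBasis (Fin N) ℝ T) :
    ∑ f : Fin n → Fin N, o.volumeForm (fun i => b (f i)) ^ 2 = (n.factorial : ℝ) := by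
  subst hN
  have h : ∀ f : Fin N → Fin N, o.volumeForm (fun i => b (f i)) ^ 2 =
      if Function.Injective f then 1 else 0 := by
    intro f
    split_ifs with hf
    · let τ : Equiv.Perm (Fin N) := Equiv.ofBijective f (Finite.injective_iff_bijective.1 hf)
      have h1 : (fun i => b (f i)) = b ∘ τ := rfl
      rw [h1, o.volumeForm.map_perm, ← sq_abs, Units.smul_def, zsmul_eq_mul, abs_mul,
        o.abs_volumeForm_apply_of_orthonormal]
      rcases Int.units_eq_one_or (Equiv.Perm.sign τ) with hh | hh <;> rw [hh] <;> simp
    · simp only [Function.Injective, not_forall] at hf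
      obtain ⟨i, j, hij, hne⟩ := hf
      rw [o.volumeForm.map_eq_zero_of_eq _ (i := i) (j := j) (by rw [hij]) hne]
      simp
  rw [Finset.sum_congr rfl fun f _ => h f, Finset.sum_boole]
  norm_cast
  rw [← Fintype.card_subtype, Fintype.card_congr (Equiv.subtypeInjectiveEquivEmbedding _ _),
    Fintype.card_embedding_eq]
  simp [Nat.descFactorial_self]

end InnerProduct

/-! ### The Lie derivative in coordinates -/

section LieCoordinates

variable {E : Type*} [NormedAddCommGroup E] [NormedSpace ℝ E] [FiniteDimensional ℝ E]

/-- The coordinate expression of the Lie derivative of the form `b` along the vector field `X`. -/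
def lieCoord {k : ℕ} (s : Set E) (X : E → E) (b : E → E [⋀^Fin k]→L[ℝ] ℝ) (y : E) :
    E [⋀^Fin k]→L[ℝ] ℝ :=
  fderivWithin ℝ b s y (X y) + derivAct (fderivWithin ℝ X s y).toLinearMap (b y)

/-- The Lie derivative commutes with pullbacks. -/
theorem lieCoord_pullback {k : ℕ} {s t : Set E} {φ : E → E} {X₁ X₂ : E → E}
    {b₁ b₂ : E → E [⋀^Fin k]→L[ℝ] ℝ} {y : E} (hs : UniqueDiffOn ℝ s) (hys : y ∈ s)
    (hyc : y ∈ closure (interior s)) (hφ : ContDiffWithinAt ℝ ∞ φ s y) (hst : MapsTo φ s t)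
    (hX₁ : DifferentiableWithinAt ℝ X₁ s y) (hX₂ : DifferentiableWithinAt ℝ X₂ t (φ y))
    (hb₂ : DifferentiableWithinAt ℝ b₂ t (φ y))
    (hb : ∀ᶠ z in 𝓝[s] y, b₁ z = (b₂ (φ z)).compContinuousLinearMap (fderivWithin ℝ φ s z))
    (hX : ∀ᶠ z in 𝓝[s] y, X₂ (φ z) = fderivWithin ℝ φ s z (X₁ z)) :
    lieCoord s X₁ b₁ y =
      (lieCoord t X₂ b₂ (φ y)).compContinuousLinearMap (fderivWithin ℝ φ s y) := by
  have hdφ : DifferentiableWithinAt ℝ φ s y := hφ.differentiableWithinAt (by simp)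
  have hd2 : DifferentiableWithinAt ℝ (fderivWithin ℝ φ s) s y :=
    (hφ.fderivWithin_right (m := 1) hs (by norm_cast) hys).differentiableWithinAt one_ne_zero
  -- The crux: differentiating the pullback produces `D²φ (X₁) (w j)`, while differentiating `X₂ ∘ φ
  -- = Dφ X₁` produces `D²φ (w j) (X₁)`. Symmetry makes them agree.
  have hsymm : IsSymmSndFDerivWithinAt ℝ φ s y :=
    hφ.isSymmSndFDerivWithinAt (by simp; norm_cast) hs hyc hys
  have hu := hs y hys
  have h1 : fderivWithin ℝ b₁ s y = _ :=
    (EventuallyEq.fderivWithin_eq_of_mem hb hys).trans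
      (fderivWithin_continuousAlternatingMapCompContinuousLinearMap
        (f := fun z => b₂ (φ z)) (by exact hb₂.comp y hdφ hst) hd2 hu)
  rw [fderivWithin_fun_comp _ hb₂ hdφ hst hu] at h1
  have hX0 : X₂ (φ y) = fderivWithin ℝ φ s y (X₁ y) := hX.self_of_nhdsWithin hys
  have hb0 : b₁ y = _ := hb.self_of_nhdsWithin hys
  have h2 : fderivWithin ℝ (fun z => X₂ (φ z)) s y =
      fderivWithin ℝ (fun z => fderivWithin ℝ φ s z (X₁ z)) s y :=
    EventuallyEq.fderivWithin_eq_of_mem hX hys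
  rw [fderivWithin_fun_comp _ hX₂ hdφ hst hu, fderivWithin_clm_apply hu hd2 hX₁] at h2
  have h3 : ∀ w, fderivWithin ℝ X₂ t (φ y) (fderivWithin ℝ φ s y w) =
      fderivWithin ℝ φ s y (fderivWithin ℝ X₁ s y w) +
        fderivWithin ℝ (fderivWithin ℝ φ s) s y w (X₁ y) := fun w => by
    simpa using congrArg (fun L => L w) h2
  ext w
  simp only [lieCoord, h1, ContinuousAlternatingMap.add_apply, derivAct_apply,
    ContinuousAlternatingMap.compContinuousLinearMap_apply, hb0, ← hX0,
    _root_.add_apply, ContinuousLinearMap.comp_apply,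
    ContinuousAlternatingMap.fderivCompContinuousLinearMap_apply,
    ContinuousAlternatingMap.compContinuousLinearMapCLM_apply, add_assoc,
    ContinuousLinearMap.coe_coe, ← Finset.sum_add_distrib]
  -- The terms with the derivative of `b₂` agree; the others are compared slot by slot.
  congr 1
  refine Finset.sum_congr rfl fun j _ => ?_
  have hupd : ∀ u : E, (fun i => fderivWithin ℝ φ s y (Function.update w j u i)) =
      Function.update (fun i => fderivWithin ℝ φ s y (w i)) j (fderivWithin ℝ φ s y u) := by
    intro u
    funext i
    by_cases h : i = j
    · subst h; simp
    · simp [h]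
  have hsw := hsymm.eq (X₁ y) (w j)
  have hupd' : (fun i => (Function.update (fun _ => fderivWithin ℝ φ s y) j
      (fderivWithin ℝ (fderivWithin ℝ φ s) s y (X₁ y)) : Fin k → E →L[ℝ] E) i (w i)) =
      Function.update (fun i => fderivWithin ℝ φ s y (w i)) j
        (fderivWithin ℝ (fderivWithin ℝ φ s) s y (w j) (X₁ y)) := by
    funext i
    by_cases h : i = j
    · subst h; simp [hsw]
    · simp [h]
  simp only [Function.comp_def, hupd, hupd', h3]
  rw [add_comm, ContinuousAlternatingMap.map_update_add]

end LieCoordinates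

/-! ### Coordinate changes and coordinate expressions -/

section Charts

variable {m : ℕ} {M : Type*} [TopologicalSpace M] [ChartedSpace (EuclideanHalfSpace (m + 1)) M]

/-- The coordinate basis. -/
def stdE (m : ℕ) (j : Fin (m + 1)) : EuclideanSpace ℝ (Fin (m + 1)) := EuclideanSpace.single j 1

theorem basisFun_eq_stdE (m : ℕ) :
    ⇑(EuclideanSpace.basisFun (Fin (m + 1)) ℝ).toBasis = stdE m := by
  funext j
  simp [stdE]

/-- The coordinate change from the chart at `i` to the chart at `j`. -/
def coordChange (i j : M) : EuclideanSpace ℝ (Fin (m + 1)) → EuclideanSpace ℝ (Fin (m + 1)) :=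
  extChartAt (𝓡∂ (m + 1)) j ∘ (extChartAt (𝓡∂ (m + 1)) i).symm

theorem mapsTo_coordChange (i j : M) (s : Set (EuclideanSpace ℝ (Fin (m + 1)))) :
    MapsTo (coordChange i j) s (range (𝓡∂ (m + 1))) := fun y _ => by
  simp [coordChange, extChartAt]

variable {i j : M} {y : EuclideanSpace ℝ (Fin (m + 1))}

theorem mem_range_of_mem_target (hy : y ∈ (extChartAt (𝓡∂ (m + 1)) i).target) :
    y ∈ range (𝓡∂ (m + 1)) := extChartAt_target_subset_range i hy

theorem fderivWithin_target {F : Type*} [NormedAddCommGroup F] [NormedSpace ℝ F]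
    {f : EuclideanSpace ℝ (Fin (m + 1)) → F} (hy : y ∈ (extChartAt (𝓡∂ (m + 1)) i).target) :
    fderivWithin ℝ f (range (𝓡∂ (m + 1))) y =
      fderivWithin ℝ f (extChartAt (𝓡∂ (m + 1)) i).target y :=
  fderivWithin_congr_set (nhdsWithin_eq_iff_eventuallyEq.1
    (nhdsWithin_extChartAt_target_eq_of_mem hy).symm)

theorem vInChart_extChartAt (v : VField m M) {x : M}
    (hx : x ∈ (extChartAt (𝓡∂ (m + 1)) i).source) :
    vInChart v i (extChartAt (𝓡∂ (m + 1)) i x) = dChart i x (v x) := by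
  obtain ⟨y, hy, rfl⟩ : ∃ y ∈ (extChartAt (𝓡∂ (m + 1)) i).target,
      (extChartAt (𝓡∂ (m + 1)) i).symm y = x :=
    ⟨_, (extChartAt _ i).map_source hx, (extChartAt _ i).left_inv hx⟩
  rw [(extChartAt (𝓡∂ (m + 1)) i).right_inv hy]
  rfl

theorem eventually_mem_overlap (hy : y ∈ (extChartAt (𝓡∂ (m + 1)) i).target)
    (hj : (extChartAt (𝓡∂ (m + 1)) i).symm y ∈ (extChartAt (𝓡∂ (m + 1)) j).source) :
    ∀ᶠ z in 𝓝[range (𝓡∂ (m + 1))] y, z ∈ (extChartAt (𝓡∂ (m + 1)) i).target ∧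
      (extChartAt (𝓡∂ (m + 1)) i).symm z ∈ (extChartAt (𝓡∂ (m + 1)) j).source := by
  have h1 := extChartAt_target_mem_nhdsWithin_of_mem hy
  refine (eventually_mem_set.2 h1).and ?_
  have hc : ContinuousWithinAt (extChartAt (𝓡∂ (m + 1)) i).symm (range (𝓡∂ (m + 1))) y :=
    ((continuousOn_extChartAt_symm i) y hy).mono_of_mem_nhdsWithin h1
  exact hc ((isOpen_extChartAt_source j).mem_nhds hj)

/-- Smoothness of a vector field. -/
def IsSmoothV (v : VField m M) : Prop :=
  ∀ i : M, ContDiffOn ℝ ∞ (vInChart v i) (extChartAt (𝓡∂ (m + 1)) i).target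

theorem _root_.ContDiffOn.contDiffWithinAt_range {F : Type*} [NormedAddCommGroup F]
    [NormedSpace ℝ F] {f : EuclideanSpace ℝ (Fin (m + 1)) → F}
    (hf : ContDiffOn ℝ ∞ f (extChartAt (𝓡∂ (m + 1)) i).target)
    (hy : y ∈ (extChartAt (𝓡∂ (m + 1)) i).target) :
    ContDiffWithinAt ℝ ∞ f (range (𝓡∂ (m + 1))) y :=
  (hf y hy).mono_of_mem_nhdsWithin (extChartAt_target_mem_nhdsWithin_of_mem hy)

variable [IsManifold (𝓡∂ (m + 1)) ∞ M]

theorem dChartSymm_dChart (hy : y ∈ (extChartAt (𝓡∂ (m + 1)) i).target)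
    (w : TangentSpace (𝓡∂ (m + 1)) ((extChartAt (𝓡∂ (m + 1)) i).symm y)) :
    dChartSymm i y (dChart i ((extChartAt (𝓡∂ (m + 1)) i).symm y) w) = w :=
  congrArg (fun L => L w) (mfderivWithin_extChartAt_symm_comp_mfderiv_extChartAt hy)

theorem eq_inChart_comp {k : ℕ} (β : DForm m M k) {x : M}
    (hx : x ∈ (extChartAt (𝓡∂ (m + 1)) i).source) :
    β x = (inChart β i (extChartAt (𝓡∂ (m + 1)) i x)).compContinuousLinearMap (dChart i x) := by
  obtain ⟨y, hy, rfl⟩ : ∃ y ∈ (extChartAt (𝓡∂ (m + 1)) i).target,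
      (extChartAt (𝓡∂ (m + 1)) i).symm y = x :=
    ⟨_, (extChartAt _ i).map_source hx, (extChartAt _ i).left_inv hx⟩
  rw [(extChartAt (𝓡∂ (m + 1)) i).right_inv hy]
  ext w
  simp only [inChart, ContinuousAlternatingMap.compContinuousLinearMap_apply]
  congr 1
  funext l
  exact (dChartSymm_dChart hy (w l)).symm

theorem dChartSymm_vInChart (v : VField m M) (hy : y ∈ (extChartAt (𝓡∂ (m + 1)) i).target) :
    dChartSymm i y (vInChart v i y) = v ((extChartAt (𝓡∂ (m + 1)) i).symm y) :=
  dChartSymm_dChart hy _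

theorem contDiffWithinAt_coordChange (hy : y ∈ (extChartAt (𝓡∂ (m + 1)) i).target)
    (hj : (extChartAt (𝓡∂ (m + 1)) i).symm y ∈ (extChartAt (𝓡∂ (m + 1)) j).source) :
    ContDiffWithinAt ℝ ∞ (coordChange i j) (range (𝓡∂ (m + 1))) y :=
  contDiffWithinAt_ext_coord_change j i (by
    rw [PartialEquiv.trans_source]
    exact ⟨hy, hj⟩)

theorem fderivWithin_coordChange (hy : y ∈ (extChartAt (𝓡∂ (m + 1)) i).target)
    (hj : (extChartAt (𝓡∂ (m + 1)) i).symm y ∈ (extChartAt (𝓡∂ (m + 1)) j).source)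
    (w : EuclideanSpace ℝ (Fin (m + 1))) :
    fderivWithin ℝ (coordChange i j) (range (𝓡∂ (m + 1))) y w =
      dChart j ((extChartAt (𝓡∂ (m + 1)) i).symm y) (dChartSymm i y w) := by
  have h := mfderiv_comp_mfderivWithin (I := 𝓘(ℝ, EuclideanSpace ℝ (Fin (m + 1))))
    (I' := 𝓡∂ (m + 1)) (I'' := 𝓘(ℝ, EuclideanSpace ℝ (Fin (m + 1))))
    (f := (extChartAt (𝓡∂ (m + 1)) i).symm) (g := extChartAt (𝓡∂ (m + 1)) j)
    (s := range (𝓡∂ (m + 1))) y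
    (mdifferentiableAt_extChartAt (by rwa [← extChartAt_source (𝓡∂ (m + 1))]))
    (mdifferentiableWithinAt_extChartAt_symm hy)
    ((𝓡∂ (m + 1)).uniqueMDiffOn _ (mem_range_of_mem_target hy))
  rw [← mfderivWithin_eq_fderivWithin]
  exact congrArg (fun L => L w) h

theorem inChart_coordChange {k : ℕ} (β : DForm m M k)
    (hy : y ∈ (extChartAt (𝓡∂ (m + 1)) i).target)
    (hj : (extChartAt (𝓡∂ (m + 1)) i).symm y ∈ (extChartAt (𝓡∂ (m + 1)) j).source) :
    inChart β i y = (inChart β j (coordChange i j y)).compContinuousLinearMap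
      (fderivWithin ℝ (coordChange i j) (range (𝓡∂ (m + 1))) y) := by
  ext w
  conv_lhs => rw [inChart, eq_inChart_comp β hj]
  simp only [ContinuousAlternatingMap.compContinuousLinearMap_apply]
  congr 1
  funext l
  exact (fderivWithin_coordChange hy hj (w l)).symm

theorem vInChart_coordChange (v : VField m M)
    (hy : y ∈ (extChartAt (𝓡∂ (m + 1)) i).target)
    (hj : (extChartAt (𝓡∂ (m + 1)) i).symm y ∈ (extChartAt (𝓡∂ (m + 1)) j).source) :
    vInChart v j (coordChange i j y) =
      fderivWithin ℝ (coordChange i j) (range (𝓡∂ (m + 1))) y (vInChart v i y) := by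
  rw [fderivWithin_coordChange hy hj, dChartSymm_vInChart v hy]
  exact vInChart_extChartAt v hj

/-- At each point `lieD` uses that point's own chart, which moves with the point. Invariance under
the coordinate change allows a fixed chart to be used on its whole target, so that smoothness can be
discussed. -/
theorem inChart_lieD {k : ℕ} {v : VField m M} {β : DForm m M k} (hv : IsSmoothV v)
    (hβ : IsSmooth β) (hy : y ∈ (extChartAt (𝓡∂ (m + 1)) i).target) :
    inChart (lieD v β) i y =
      lieCoord (range (𝓡∂ (m + 1))) (vInChart v i) (inChart β i) y := by
  set x : M := (extChartAt (𝓡∂ (m + 1)) i).symm y with hx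
  have hj : (extChartAt (𝓡∂ (m + 1)) i).symm y ∈ (extChartAt (𝓡∂ (m + 1)) x).source :=
    mem_extChartAt_source x
  have hyr := mem_range_of_mem_target hy
  have hx0 : coordChange i x y ∈ (extChartAt (𝓡∂ (m + 1)) x).target :=
    (extChartAt (𝓡∂ (m + 1)) x).map_source hj
  have hov := eventually_mem_overlap hy hj
  rw [lieCoord_pullback (𝓡∂ (m + 1)).uniqueDiffOn hyr
    ((𝓡∂ (m + 1)).range_subset_closure_interior hyr) (contDiffWithinAt_coordChange hy hj)
    (mapsTo_coordChange i x _)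
    (((hv i).contDiffWithinAt_range hy).differentiableWithinAt (by simp))
    (((hv x).contDiffWithinAt_range hx0).differentiableWithinAt (by simp))
    (((hβ x).contDiffWithinAt_range hx0).differentiableWithinAt (by simp))
    (hov.mono fun z hz => inChart_coordChange β hz.1 hz.2)
    (hov.mono fun z hz => vInChart_coordChange v hz.1 hz.2)]
  ext w
  simp only [ContinuousAlternatingMap.compContinuousLinearMap_apply]
  have : (⇑(fderivWithin ℝ (coordChange i x) (range (𝓡∂ (m + 1))) y) ∘ w) =
      fun l => dChart x x (dChartSymm i y (w l)) :=
    funext fun l => fderivWithin_coordChange hy hj (w l)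
  rw [this]
  rfl

end Charts

instance (m : ℕ) : T2Space (EuclideanSpace ℝ (Fin (m + 1))) :=
  TopologicalSpace.t2Space_of_metrizableSpace

/-! ### Functions, top forms and their Lie derivatives in coordinates -/

section Smoothness

variable {m : ℕ} {M : Type*} [TopologicalSpace M] [ChartedSpace (EuclideanHalfSpace (m + 1)) M]
  {i : M} {y : EuclideanSpace ℝ (Fin (m + 1))}

/-- The coordinate expression of a function. -/
def fInChart (f : M → ℝ) (i : M) (y : EuclideanSpace ℝ (Fin (m + 1))) : ℝ :=
  f ((extChartAt (𝓡∂ (m + 1)) i).symm y)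

/-- The function underlying a `0`-form. -/
def fval (f : DForm m M 0) (x : M) : ℝ := f x Fin.elim0

/-- The coefficient of a top form in the chart at `i`. -/
def topCoef (β : DForm m M (m + 1)) (i : M) (y : EuclideanSpace ℝ (Fin (m + 1))) : ℝ :=
  inChart β i y (stdE m)

theorem topCoef_fsmul (f : DForm m M 0) (β : DForm m M (m + 1)) :
    topCoef (fsmul f β) i y = fInChart (fval f) i y * topCoef β i y := rfl

theorem inChart_zero_eq (f : DForm m M 0) :
    inChart f i y = ContinuousAlternatingMap.constOfIsEmpty ℝ (EuclideanSpace ℝ (Fin (m + 1)))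
      (Fin 0) (fInChart (fval f) i y) := by
  ext w
  simp only [inChart, ContinuousAlternatingMap.compContinuousLinearMap_apply,
    ContinuousAlternatingMap.constOfIsEmpty_apply, fInChart, fval]
  exact congrArg _ (Subsingleton.elim _ _)

theorem inChart_top_eq (β : DForm m M (m + 1)) :
    inChart β i y = topCoef β i y •
      toCont (EuclideanSpace.basisFun (Fin (m + 1)) ℝ).toBasis.det := by
  refine topForm_ext (EuclideanSpace.basisFun (Fin (m + 1)) ℝ).toBasis ?_
  rw [ContinuousAlternatingMap.smul_apply, toCont_apply, Basis.det_self, basisFun_eq_stdE]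
  simp [topCoef]

theorem isSmooth_zero_iff {f : DForm m M 0} :
    IsSmooth f ↔
      ∀ i : M, ContDiffOn ℝ ∞ (fInChart (fval f) i) (extChartAt (𝓡∂ (m + 1)) i).target := by
  refine forall_congr' fun i => ⟨fun h => ?_, fun h => ?_⟩
  · exact (ContinuousAlternatingMap.constOfIsEmptyLIE ℝ (EuclideanSpace ℝ (Fin (m + 1))) ℝ
      (Fin 0)).symm.contDiff.comp_contDiffOn h |>.congr fun y _ => by
        simp [inChart_zero_eq]
  · exact (ContinuousAlternatingMap.constOfIsEmptyLIE ℝ (EuclideanSpace ℝ (Fin (m + 1))) ℝ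
      (Fin 0)).contDiff.comp_contDiffOn h |>.congr fun y _ => inChart_zero_eq f

theorem contDiffOn_apply {k : ℕ} {β : EuclideanSpace ℝ (Fin (m + 1)) →
    EuclideanSpace ℝ (Fin (m + 1)) [⋀^Fin k]→L[ℝ] ℝ} {s : Set (EuclideanSpace ℝ (Fin (m + 1)))}
    (h : ContDiffOn ℝ ∞ β s) (v : Fin k → EuclideanSpace ℝ (Fin (m + 1))) :
    ContDiffOn ℝ ∞ (fun y => β y v) s :=
  (ContinuousAlternatingMap.apply ℝ _ ℝ v).contDiff.comp_contDiffOn h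

theorem isSmooth_top_iff {β : DForm m M (m + 1)} :
    IsSmooth β ↔ ∀ i : M, ContDiffOn ℝ ∞ (topCoef β i) (extChartAt (𝓡∂ (m + 1)) i).target := by
  refine forall_congr' fun i => ⟨fun h => contDiffOn_apply h _, fun h => ?_⟩
  exact (h.smul (contDiffOn_const
    (c := toCont (EuclideanSpace.basisFun (Fin (m + 1)) ℝ).toBasis.det))).congr
      fun y _ => inChart_top_eq β

theorem IsSmooth.fsmul {k : ℕ} {f : DForm m M 0} {β : DForm m M k} (hf : IsSmooth f)
    (hβ : IsSmooth β) : IsSmooth (fsmul f β) := fun i =>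
  (isSmooth_zero_iff.1 hf i).smul (hβ i)

theorem IsSmooth.neg {k : ℕ} {β : DForm m M k} (hβ : IsSmooth β) : IsSmooth (-β) := fun i =>
  (hβ i).neg

theorem wedge_zero_left {l : ℕ} (h : 0 + l = l) (f : DForm m M 0) (β : DForm m M l) :
    wedge h f β = fsmul f β := funext fun x => wedgeAt_zero_left h (f x) (β x)

theorem wedge_zero_right {k : ℕ} (h : k + 0 = k) (α : DForm m M k) (f : DForm m M 0) :
    wedge h α f = fsmul f α := funext fun x => wedgeAt_zero_right h (α x) (f x)

theorem extDerivWithin_inChart_zero (f : DForm m M 0) (hy : y ∈ range (𝓡∂ (m + 1))) :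
    extDerivWithin (inChart f i) (range (𝓡∂ (m + 1))) y =
      ContinuousAlternatingMap.ofSubsingleton ℝ _ ℝ (0 : Fin 1)
        (fderivWithin ℝ (fInChart (fval f) i) (range (𝓡∂ (m + 1))) y) := by
  rw [← extDerivWithin_constOfIsEmpty _ ((𝓡∂ (m + 1)).uniqueDiffOn y hy)]
  congr 1
  funext z
  exact inChart_zero_eq f

/-- The Lie derivative of a function is the value of its differential. -/
theorem lieD_zero (v : VField m M) (f : DForm m M 0) (x : M) :
    lieD v f x Fin.elim0 = extD f x (fun _ => v x) := by
  have hx : extChartAt (𝓡∂ (m + 1)) x x ∈ range (𝓡∂ (m + 1)) :=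
    mem_range_of_mem_target (mem_extChartAt_target x)
  have h1 : inChart f x = (ContinuousAlternatingMap.constOfIsEmptyLIE ℝ
      (EuclideanSpace ℝ (Fin (m + 1))) ℝ (Fin 0)) ∘ (fInChart (fval f) x) := by
    funext z
    exact inChart_zero_eq f
  rw [extD, extDerivWithin_inChart_zero f hx, lieD,
    ContinuousAlternatingMap.compContinuousLinearMap_apply, ContinuousAlternatingMap.add_apply,
    derivAct_apply, h1, LinearIsometryEquiv.comp_fderivWithin _ ((𝓡∂ (m + 1)).uniqueDiffOn _ hx),
    vInChart_extChartAt v (mem_extChartAt_source x)]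
  simp

theorem _root_.ContDiffOn.fderivWithin_range {F : Type*} [NormedAddCommGroup F]
    [NormedSpace ℝ F] {f : EuclideanSpace ℝ (Fin (m + 1)) → F}
    (hf : ContDiffOn ℝ ∞ f (extChartAt (𝓡∂ (m + 1)) i).target) :
    ContDiffOn ℝ ∞ (fderivWithin ℝ f (range (𝓡∂ (m + 1)))) (extChartAt (𝓡∂ (m + 1)) i).target :=
  (hf.fderivWithin (uniqueDiffOn_extChartAt_target i) (by simp)).congr
    fun _ hy => fderivWithin_target hy

/-- By linearity `u` may be a basis vector, and any other than the `j`-th repeats an entry. This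
produces the trace of `D X` in the Lie derivative and the normal component at the boundary. -/
theorem apply_update_stdE (b : EuclideanSpace ℝ (Fin (m + 1)) [⋀^Fin (m + 1)]→L[ℝ] ℝ)
    (j : Fin (m + 1)) (u : EuclideanSpace ℝ (Fin (m + 1))) :
    b (Function.update (stdE m) j u) = u j * b (stdE m) := by
  have h : b.toMultilinearMap.toLinearMap (stdE m) j =
      (b (stdE m)) • (EuclideanSpace.proj j : _ →L[ℝ] ℝ).toLinearMap := by
    refine (EuclideanSpace.basisFun (Fin (m + 1)) ℝ).toBasis.ext fun k => ?_
    rw [basisFun_eq_stdE]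
    change b (Function.update (stdE m) j (stdE m k)) = b (stdE m) * stdE m k j
    by_cases hk : k = j
    · subst hk
      rw [Function.update_eq_self]
      simp [stdE]
    · rw [b.map_eq_zero_of_eq _ (i := j) (j := k) (by simp [hk]) (Ne.symm hk)]
      simp [stdE, Ne.symm hk]
  rw [mul_comm]
  exact congrArg (fun L => L u) h

/-- The divergence in coordinates, within the half-space. -/
def divCoord (X : EuclideanSpace ℝ (Fin (m + 1)) → EuclideanSpace ℝ (Fin (m + 1)))
    (y : EuclideanSpace ℝ (Fin (m + 1))) : ℝ :=
  ∑ j, fderivWithin ℝ X (range (𝓡∂ (m + 1))) y (stdE m j) j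

theorem divCoord_smul {f : EuclideanSpace ℝ (Fin (m + 1)) → ℝ}
    {X : EuclideanSpace ℝ (Fin (m + 1)) → EuclideanSpace ℝ (Fin (m + 1))}
    (hy : y ∈ range (𝓡∂ (m + 1)))
    (hf : DifferentiableWithinAt ℝ f (range (𝓡∂ (m + 1))) y)
    (hX : DifferentiableWithinAt ℝ X (range (𝓡∂ (m + 1))) y) :
    divCoord (fun z => f z • X z) y =
      fderivWithin ℝ f (range (𝓡∂ (m + 1))) y (X y) + f y * divCoord X y := by
  have hX' : X y = ∑ j, X y j • stdE m j := by
    conv_lhs => rw [← (EuclideanSpace.basisFun (Fin (m + 1)) ℝ).sum_repr (X y)]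
    simp [stdE]
  conv_rhs => rw [hX', map_sum]
  rw [divCoord, divCoord, Finset.mul_sum, ← Finset.sum_add_distrib,
    fderivWithin_fun_smul ((𝓡∂ (m + 1)).uniqueDiffOn y hy) hf hX]
  refine Finset.sum_congr rfl fun j _ => ?_
  simp only [_root_.add_apply, _root_.smul_apply, PiLp.add_apply, PiLp.smul_apply,
    ContinuousLinearMap.smulRight_apply, smul_eq_mul, map_smul]
  ring

variable [IsManifold (𝓡∂ (m + 1)) ∞ M]

/-- The chain rule along the coordinate change identifies the differential taken in the chart at the
point with the one taken in the chart at `i`. -/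
theorem inChart_extD_zero {f : DForm m M 0} (hf : IsSmooth f)
    (hy : y ∈ (extChartAt (𝓡∂ (m + 1)) i).target) :
    inChart (extD f) i y = ContinuousAlternatingMap.ofSubsingleton ℝ _ ℝ (0 : Fin 1)
      (fderivWithin ℝ (fInChart (fval f) i) (range (𝓡∂ (m + 1))) y) := by
  set x : M := (extChartAt (𝓡∂ (m + 1)) i).symm y with hx
  have hj : (extChartAt (𝓡∂ (m + 1)) i).symm y ∈ (extChartAt (𝓡∂ (m + 1)) x).source :=
    mem_extChartAt_source x
  have hyr := mem_range_of_mem_target hy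
  have hx0 : coordChange i x y ∈ (extChartAt (𝓡∂ (m + 1)) x).target :=
    (extChartAt (𝓡∂ (m + 1)) x).map_source hj
  have hcomp : fInChart (fval f) i =ᶠ[𝓝[range (𝓡∂ (m + 1))] y]
      fun z => fInChart (fval f) x (coordChange i x z) :=
    (eventually_mem_overlap hy hj).mono fun z hz =>
      (congrArg (fval f) ((extChartAt (𝓡∂ (m + 1)) x).left_inv hz.2)).symm
  rw [hcomp.fderivWithin_eq_of_mem hyr, fderivWithin_fun_comp _
    (((isSmooth_zero_iff.1 hf x).contDiffWithinAt_range hx0).differentiableWithinAt (by simp))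
    ((contDiffWithinAt_coordChange hy hj).differentiableWithinAt (by simp))
    (mapsTo_coordChange i x _) ((𝓡∂ (m + 1)).uniqueDiffOn y hyr)]
  ext w
  change extD f x (fun l => dChartSymm i y (w l)) =
    fderivWithin ℝ (fInChart (fval f) x) _ _ (fderivWithin ℝ (coordChange i x) _ y (w 0))
  rw [extD, extDerivWithin_inChart_zero f (mem_range_of_mem_target (mem_extChartAt_target x)),
    fderivWithin_coordChange hy hj]
  rfl

theorem IsSmooth.extD_zero {f : DForm m M 0} (hf : IsSmooth f) : IsSmooth (extD f) := fun i =>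
  ((ContinuousAlternatingMap.ofSubsingletonLIE (𝕜 := ℝ) (E := EuclideanSpace ℝ (Fin (m + 1)))
    (F := ℝ) (0 : Fin 1)).contDiff.comp_contDiffOn
      (isSmooth_zero_iff.1 hf i).fderivWithin_range).congr fun _ hy => inChart_extD_zero hf hy

theorem extD_zero_apply {f : DForm m M 0} (hf : IsSmooth f) (v : VField m M)
    (hy : y ∈ (extChartAt (𝓡∂ (m + 1)) i).target) :
    extD f ((extChartAt (𝓡∂ (m + 1)) i).symm y)
        (fun _ => v ((extChartAt (𝓡∂ (m + 1)) i).symm y)) =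
      fderivWithin ℝ (fInChart (fval f) i) (range (𝓡∂ (m + 1))) y (vInChart v i y) := by
  have h := congrArg (fun L => L (fun _ => vInChart v i y)) (inChart_extD_zero hf hy)
  simp only [inChart, ContinuousAlternatingMap.compContinuousLinearMap_apply,
    Function.comp_def, dChartSymm_vInChart v hy] at h
  exact h

/-- The Lie derivative of a top form in coordinates is a divergence. -/
theorem topCoef_lieD {v : VField m M} {β : DForm m M (m + 1)} (hv : IsSmoothV v)
    (hβ : IsSmooth β) (hy : y ∈ (extChartAt (𝓡∂ (m + 1)) i).target) :
    topCoef (lieD v β) i y = divCoord (fun z => topCoef β i z • vInChart v i z) y := by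
  have hyr := mem_range_of_mem_target hy
  have hd : DifferentiableWithinAt ℝ (inChart β i) (range (𝓡∂ (m + 1))) y :=
    ((hβ i).contDiffWithinAt_range hy).differentiableWithinAt (by simp)
  rw [divCoord_smul hyr
    (((isSmooth_top_iff.1 hβ i).contDiffWithinAt_range hy).differentiableWithinAt (by simp))
    (((hv i).contDiffWithinAt_range hy).differentiableWithinAt (by simp)),
    topCoef, inChart_lieD hv hβ hy, lieCoord, ContinuousAlternatingMap.add_apply, derivAct_apply]
  -- Leibniz for `div (A X)`: differentiating the coefficient gives the first summand, and the
  -- derivation action of `D X` on a top form is its trace, the second.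
  congr 1
  · exact (fderivWithin_continuousAlternatingMap_apply_const_apply
      ((𝓡∂ (m + 1)).uniqueDiffOn y hyr) hd _ _).symm
  · simp only [apply_update_stdE, divCoord, Finset.mul_sum]
    refine Finset.sum_congr rfl fun j _ => ?_
    rw [mul_comm]
    rfl

theorem IsSmooth.lieD_top {v : VField m M} {β : DForm m M (m + 1)} (hv : IsSmoothV v)
    (hβ : IsSmooth β) : IsSmooth (lieD v β) := by
  refine isSmooth_top_iff.2 fun i => ?_
  have h1 := ((isSmooth_top_iff.1 hβ i).smul (hv i)).fderivWithin_range
  refine ContDiffOn.congr (f := divCoord (fun z => topCoef β i z • vInChart v i z)) ?_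
    fun y hy => topCoef_lieD hv hβ hy
  refine ContDiffOn.sum fun j _ => ?_
  exact (EuclideanSpace.proj j : _ →L[ℝ] ℝ).contDiff.comp_contDiffOn
    (h1.clm_apply contDiffOn_const)

theorem IsSmooth.lieD_zero {v : VField m M} {f : DForm m M 0} (hv : IsSmoothV v)
    (hf : IsSmooth f) : IsSmooth (lieD v f) := by
  refine isSmooth_zero_iff.2 fun i => ?_
  exact ((isSmooth_zero_iff.1 hf i).fderivWithin_range.clm_apply (hv i)).congr fun y hy =>
    (FluidForms.lieD_zero v f _).trans (extD_zero_apply hf v hy)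

end Smoothness

/-! ### Smoothness of the volume form, the Hodge star and the field of an `m`-form -/

section Volume

variable {m : ℕ} {M : Type*} [TopologicalSpace M] [ChartedSpace (EuclideanHalfSpace (m + 1)) M]
  {i : M} {y : EuclideanSpace ℝ (Fin (m + 1))}

/-- The contraction of a form with a vector field. -/
def contract {k : ℕ} (v : VField m M) (β : DForm m M (k + 1)) : DForm m M k :=
  fun x => interiorAt (v x) (β x)

theorem inChart_contract [IsManifold (𝓡∂ (m + 1)) ∞ M] {k : ℕ}
    (v : VField m M) (β : DForm m M (k + 1)) (hy : y ∈ (extChartAt (𝓡∂ (m + 1)) i).target) :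
    inChart (contract v β) i y = interiorAt (vInChart v i y) (inChart β i y) := by
  ext u
  simp only [contract, inChart, ContinuousAlternatingMap.compContinuousLinearMap_apply,
    interiorAt_apply]
  congr 1
  funext l
  refine Fin.cases ?_ (fun l => ?_) l
  · exact (dChartSymm_vInChart v hy).symm
  · rfl

/-- The vector field `∂_j` of the chart at `i` is smooth along the chart. -/
theorem contMDiffOn_dChartSymm [IsManifold (𝓡∂ (m + 1)) ∞ M] (i : M)
    (u : EuclideanSpace ℝ (Fin (m + 1))) :
    ContMDiffOn 𝓘(ℝ, EuclideanSpace ℝ (Fin (m + 1))) (𝓡∂ (m + 1)).tangent ∞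
      (fun y => (⟨(extChartAt (𝓡∂ (m + 1)) i).symm y, dChartSymm i y u⟩ :
        TangentBundle (𝓡∂ (m + 1)) M)) (extChartAt (𝓡∂ (m + 1)) i).target := by
  have h1 : ContMDiffOn 𝓘(ℝ, EuclideanSpace ℝ (Fin (m + 1))) (𝓡∂ (m + 1)) ∞
      (extChartAt (𝓡∂ (m + 1)) i).symm (extChartAt (𝓡∂ (m + 1)) i).target :=
    contMDiffOn_extChartAt_symm i
  -- The coordinate field is the tangent map of the inverse chart applied to the constant field `u`.
  have h2 := h1.contMDiffOn_tangentMapWithin (m := ∞) (by simp)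
    (uniqueDiffOn_extChartAt_target i).uniqueMDiffOn
  have h3 : ContMDiff 𝓘(ℝ, EuclideanSpace ℝ (Fin (m + 1)))
      𝓘(ℝ, EuclideanSpace ℝ (Fin (m + 1))).tangent ∞
      (fun y => (⟨y, u⟩ : TangentBundle 𝓘(ℝ, EuclideanSpace ℝ (Fin (m + 1)))
        (EuclideanSpace ℝ (Fin (m + 1))))) :=
    contMDiff_vectorSpace_iff_contDiff.2 contDiff_const
  refine (h2.comp h3.contMDiffOn (fun y hy => hy)).congr fun y hy => ?_
  refine congrArg (TotalSpace.mk _) ?_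
  have h4 : mfderivWithin 𝓘(ℝ, EuclideanSpace ℝ (Fin (m + 1))) (𝓡∂ (m + 1))
      (extChartAt (𝓡∂ (m + 1)) i).symm (range (𝓡∂ (m + 1))) y =
      mfderivWithin 𝓘(ℝ, EuclideanSpace ℝ (Fin (m + 1))) (𝓡∂ (m + 1))
      (extChartAt (𝓡∂ (m + 1)) i).symm (extChartAt (𝓡∂ (m + 1)) i).target y :=
    mfderivWithin_congr_set (nhdsWithin_eq_iff_eventuallyEq.1
      (nhdsWithin_extChartAt_target_eq_of_mem hy).symm)
  exact congrArg (fun L => L u) h4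

variable [RiemannianBundle (fun x : M => TangentSpace (𝓡∂ (m + 1)) x)]

theorem vol_ne_zero (o : ManifoldOrientation m M) (x : M) : vol o x ≠ 0 := by
  intro h
  let b : OrthonormalBasis (Fin (m + 1)) ℝ (TangentSpace (𝓡∂ (m + 1)) x) :=
    (o.orient x).finOrthonormalBasis m.succ_pos Fact.out
  have h1 := (o.orient x).abs_volumeForm_apply_of_orthonormal b
  have h2 : (o.orient x).volumeForm b = 0 := congrArg (fun f => f b) h
  rw [h2] at h1
  simp at h1

/-- Contraction with a nonzero top form is onto, so `Function.invFun` is a genuine right inverse. -/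
theorem interiorAt_hat (o : ManifoldOrientation m M) (w : DForm m M m) (x : M) :
    interiorAt (hat o w x) (vol o x) = w x :=
  Function.invFun_eq (interiorAt_surjective Fact.out (vol_ne_zero o x) (w x))

theorem contract_hat (o : ManifoldOrientation m M) (w : DForm m M m) :
    contract (hat o w) (vol o) = w := funext fun x => interiorAt_hat o w x

theorem hat_contract (o : ManifoldOrientation m M) (v : VField m M) :
    hat o (contract v (vol o)) = v := funext fun x =>
  interiorAt_injective Fact.out (vol_ne_zero o x) (interiorAt_hat o _ x)

/-- The top form `g vol`. -/
def density (o : ManifoldOrientation m M) (g : M → ℝ) : DForm m M (m + 1) := fun x => g x • vol o x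

theorem wedge_one (h : 1 + m = m + 1) (o : ManifoldOrientation m M) (α : DForm m M 1)
    (w : DForm m M m) : wedge h α w = density o (fun x => α x (fun _ => hat o w x)) := by
  funext x
  conv_lhs => rw [wedge, ← interiorAt_hat o w x, wedgeAt_interiorAt h Fact.out]
  rfl

theorem exists_eq_smul_vol (o : ManifoldOrientation m M) (a : DForm m M (m + 1)) (x : M) :
    ∃ c : ℝ, a x = c • vol o x := by
  let b : Basis (Fin (m + 1)) ℝ (TangentSpace (𝓡∂ (m + 1)) x) := finBasisOfFinrankEq ℝ _ Fact.out
  have hb : vol o x b ≠ 0 := fun h0 => vol_ne_zero o x (topForm_ext b (by simpa using h0))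
  refine ⟨a x b / vol o x b, topForm_ext b ?_⟩
  rw [ContinuousAlternatingMap.smul_apply, smul_eq_mul, div_mul_cancel₀ _ hb]

/-- The Hodge star of a top form is its density with respect to the volume form. -/
theorem density_star (h : 0 + (m + 1) = m + 1) (o : ManifoldOrientation m M)
    (a : DForm m M (m + 1)) : density o (fval (star h o a)) = a := by
  funext x
  obtain ⟨c, hc⟩ := exists_eq_smul_vol o a x
  -- Each term of the sum in `star` is `c` times a squared value of the volume form; these squares
  -- add up to `(m + 1)!`.
  have hval : fval (star h o a) x = c := by
    rw [fval, star, ContinuousAlternatingMap.smul_apply, ContinuousAlternatingMap.sum_apply]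
    have hterm : ∀ f : Fin (m + 1) → Fin (finrank ℝ (TangentSpace (𝓡∂ (m + 1)) x)),
        (a x (fun i => stdOrthonormalBasis ℝ (TangentSpace (𝓡∂ (m + 1)) x) (f i)) •
          contractFirst (m + 1)
            (toCont ((vol o x).toAlternatingMap.domDomCongr (finCongr h.symm)))
            (fun i => stdOrthonormalBasis ℝ (TangentSpace (𝓡∂ (m + 1)) x) (f i))) Fin.elim0 =
        c * (o.orient x).volumeForm
          (fun i => stdOrthonormalBasis ℝ (TangentSpace (𝓡∂ (m + 1)) x) (f i)) ^ 2 := by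
      intro f
      rw [ContinuousAlternatingMap.smul_apply, contractFirst_zero_apply, hc, toCont_apply,
        AlternatingMap.domDomCongr_apply, ContinuousAlternatingMap.smul_apply, smul_eq_mul,
        smul_eq_mul, sq, mul_assoc]
      rfl
    rw [Finset.sum_congr rfl fun f _ => hterm f, ← Finset.mul_sum,
      sum_volumeForm_sq (o.orient x) Fact.out (stdOrthonormalBasis ℝ _)]
    have : ((m + 1).factorial : ℝ) ≠ 0 := by positivity
    rw [smul_eq_mul, mul_left_comm, inv_mul_cancel₀ this, mul_one]
  rw [density, hval, hc]

theorem topCoef_density (o : ManifoldOrientation m M) (g : M → ℝ) :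
    topCoef (density o g) i y = fInChart g i y * topCoef (vol o) i y := rfl

theorem chartSign_eq (o : ManifoldOrientation m M) :
    chartSign o.orient i y = (SignType.sign (topCoef (vol o) i y) : ℝ) := rfl

theorem fsmul_eq_density (o : ManifoldOrientation m M) (f : DForm m M 0) (g : M → ℝ) :
    fsmul f (density o g) = density o (fun x => fval f x * g x) := by
  funext x
  exact smul_smul _ _ _

/-- The Gram determinant of the coordinate frame. -/
def gramDet (i : M) (y : EuclideanSpace ℝ (Fin (m + 1))) : ℝ :=
  (Matrix.of fun k l => inner ℝ (dChartSymm i y (stdE m k)) (dChartSymm i y (stdE m l))).det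

theorem topCoef_vol_sq (o : ManifoldOrientation m M) (i : M)
    (y : EuclideanSpace ℝ (Fin (m + 1))) : topCoef (vol o) i y ^ 2 = gramDet i y :=
  volumeForm_sq (o.orient _) ((o.orient _).finOrthonormalBasis m.succ_pos Fact.out) _

/-- The coefficient is split into a locally constant sign, which carries the orientation, and a
factor that depends on the metric alone. -/
theorem topCoef_vol_eq (o : ManifoldOrientation m M) (i : M)
    (y : EuclideanSpace ℝ (Fin (m + 1))) :
    topCoef (vol o) i y = chartSign o.orient i y * √(gramDet i y) := by
  rw [← topCoef_vol_sq o, Real.sqrt_sq_eq_abs, chartSign_eq, sign_mul_abs]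

variable [IsManifold (𝓡∂ (m + 1)) ∞ M]

theorem topCoef_vol_ne_zero (o : ManifoldOrientation m M)
    (hy : y ∈ (extChartAt (𝓡∂ (m + 1)) i).target) : topCoef (vol o) i y ≠ 0 := by
  intro h
  apply vol_ne_zero o ((extChartAt (𝓡∂ (m + 1)) i).symm y)
  rw [eq_inChart_comp (vol o) ((extChartAt _ i).map_target hy),
    (extChartAt (𝓡∂ (m + 1)) i).right_inv hy, inChart_top_eq, h, zero_smul]
  rfl

theorem chartSign_eq_or (o : ManifoldOrientation m M)
    (hy : y ∈ (extChartAt (𝓡∂ (m + 1)) i).target) :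
    chartSign o.orient i y = 1 ∨ chartSign o.orient i y = -1 := by
  rw [chartSign_eq]
  rcases lt_or_gt_of_ne (topCoef_vol_ne_zero o hy) with h | h
  · right; simp [sign_neg h]
  · left; simp [sign_pos h]

/-- A continuous function with values `±1` is locally constant: values at distance less than `1`
coincide. -/
theorem eventually_chartSign_eq (o : ManifoldOrientation m M)
    (hy : y ∈ (extChartAt (𝓡∂ (m + 1)) i).target) :
    ∀ᶠ z in 𝓝[(extChartAt (𝓡∂ (m + 1)) i).target] y,
      chartSign o.orient i z = chartSign o.orient i y := by
  have h1 := (o.continuousOn_sign i y hy).eventually (Metric.ball_mem_nhds _ one_pos)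
  filter_upwards [h1, self_mem_nhdsWithin] with z hz hzt
  rw [Real.dist_eq, abs_lt] at hz
  rcases chartSign_eq_or o hy with h | h <;> rcases chartSign_eq_or o hzt with h' | h' <;>
    linarith [hz.1, hz.2]

theorem contDiffOn_chartSign (o : ManifoldOrientation m M) (i : M) :
    ContDiffOn ℝ ∞ (chartSign o.orient i) (extChartAt (𝓡∂ (m + 1)) i).target := fun y hy =>
  (contDiffWithinAt_const (c := chartSign o.orient i y)).congr_of_eventuallyEq
    (eventually_chartSign_eq o hy) rfl

variable [IsContMDiffRiemannianBundle (𝓡∂ (m + 1)) ∞ (EuclideanSpace ℝ (Fin (m + 1)))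
  (fun x : M => TangentSpace (𝓡∂ (m + 1)) x)]

theorem contDiffOn_metric (i : M) (u u' : EuclideanSpace ℝ (Fin (m + 1))) :
    ContDiffOn ℝ ∞ (fun y => inner ℝ (dChartSymm i y u) (dChartSymm i y u'))
      (extChartAt (𝓡∂ (m + 1)) i).target :=
  contMDiffOn_iff_contDiffOn.1
    ((contMDiffOn_dChartSymm i u).inner_bundle (contMDiffOn_dChartSymm i u'))

theorem contDiffOn_gramDet (i : M) :
    ContDiffOn ℝ ∞ (gramDet i) (extChartAt (𝓡∂ (m + 1)) i).target := by
  unfold gramDet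
  simp only [Matrix.det_apply, Matrix.of_apply]
  refine ContDiffOn.sum fun σ _ => ContDiffOn.const_smul _ ?_
  exact contDiffOn_prod fun k _ => contDiffOn_metric i _ _

/-- The Gram determinant is the square of a nonvanishing coefficient, so its square root is smooth.
-/
theorem isSmooth_vol (o : ManifoldOrientation m M) : IsSmooth (vol o) := by
  refine isSmooth_top_iff.2 fun i => ?_
  refine ((contDiffOn_chartSign o i).mul ((contDiffOn_gramDet i).sqrt fun y hy => ?_)).congr
    fun y _ => topCoef_vol_eq o i y
  rw [← topCoef_vol_sq o]
  exact pow_ne_zero 2 (topCoef_vol_ne_zero o hy)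

theorem contDiffOn_topCoef_vol (o : ManifoldOrientation m M) (i : M) :
    ContDiffOn ℝ ∞ (topCoef (vol o) i) (extChartAt (𝓡∂ (m + 1)) i).target :=
  isSmooth_top_iff.1 (isSmooth_vol o) i

theorem isSmooth_density (o : ManifoldOrientation m M) {g : M → ℝ}
    (hg : ∀ i : M, ContDiffOn ℝ ∞ (fInChart g i) (extChartAt (𝓡∂ (m + 1)) i).target) :
    IsSmooth (density o g) :=
  isSmooth_top_iff.2 fun i => (hg i).mul (contDiffOn_topCoef_vol o i)

/-- In a chart the star of a top form is the quotient of its coefficient by that of the volume form;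
the pointwise chosen orthonormal bases disappear. -/
theorem isSmooth_star (h : 0 + (m + 1) = m + 1) (o : ManifoldOrientation m M)
    {a : DForm m M (m + 1)} (ha : IsSmooth a) : IsSmooth (star h o a) := by
  refine isSmooth_zero_iff.2 fun i => ?_
  refine ((isSmooth_top_iff.1 ha i).div (isSmooth_top_iff.1 (isSmooth_vol o) i)
    fun y hy => topCoef_vol_ne_zero o hy).congr fun y hy => ?_
  rw [Pi.div_apply, eq_div_iff (topCoef_vol_ne_zero o hy), ← topCoef_density, density_star]

/-- The field is given by a choice, so its components are recovered from `dy_k ∧ ω = v_k vol` as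
quotients of smooth coefficients. -/
theorem isSmoothV_hat (o : ManifoldOrientation m M) {w : DForm m M m} (hw : IsSmooth w) :
    IsSmoothV (hat o w) := by
  intro i
  rw [contDiffOn_euclidean]
  intro k
  let α : EuclideanSpace ℝ (Fin (m + 1)) [⋀^Fin 1]→L[ℝ] ℝ :=
    ContinuousAlternatingMap.ofSubsingleton ℝ _ ℝ (0 : Fin 1) (EuclideanSpace.proj k)
  have h : 1 + m = m + 1 := Nat.add_comm 1 m
  have hsm : ContDiffOn ℝ ∞ (fun y => wedgeAt h α (inChart w i y) (stdE m))
      (extChartAt (𝓡∂ (m + 1)) i).target := by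
    have hl : ((Nat.factorial 1 * m.factorial : ℕ) : ℝ) ≠ 0 := by positivity
    refine ContDiffOn.congr (f := fun y => ((Nat.factorial 1 * m.factorial : ℕ) : ℝ)⁻¹ *
      ∑ σ : Equiv.Perm (Fin 1 ⊕ Fin m), ((Equiv.Perm.sign σ : ℤ) : ℝ) *
        (α (fun i => stdE m (finCongr h (finSumFinEquiv (σ (Sum.inl i))))) *
          inChart w i y (fun i => stdE m (finCongr h (finSumFinEquiv (σ (Sum.inr i)))))))
      ?_ fun y _ => ?_
    · refine contDiffOn_const.mul (ContDiffOn.sum fun σ _ => contDiffOn_const.mul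
        (contDiffOn_const.mul ?_))
      exact contDiffOn_apply (hw i) _
    · rw [← factorial_mul_wedgeAt_apply, inv_mul_cancel_left₀ hl]
  refine (hsm.div (isSmooth_top_iff.1 (isSmooth_vol o) i)
    fun y hy => topCoef_vol_ne_zero o hy).congr fun y hy => ?_
  rw [Pi.div_apply, eq_div_iff (topCoef_vol_ne_zero o hy)]
  conv_rhs => rw [← contract_hat o w]
  rw [inChart_contract _ _ hy, wedgeAt_interiorAt h (by simp)]
  rfl

/-- The contraction of the volume form with a smooth vector field is smooth. -/
theorem isSmooth_contract_vol (o : ManifoldOrientation m M) {v : VField m M} (hv : IsSmoothV v) :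
    IsSmooth (contract v (vol o)) := by
  intro i
  let μ := toCont (EuclideanSpace.basisFun (Fin (m + 1)) ℝ).toBasis.det
  refine ContDiffOn.congr (f := fun y => ∑ k, (topCoef (vol o) i y * vInChart v i y k) •
    interiorAt (stdE m k) μ) ?_ fun y hy => ?_
  · refine ContDiffOn.sum fun k _ => ContDiffOn.smul ((isSmooth_top_iff.1 (isSmooth_vol o) i).mul
      ((contDiffOn_euclidean.1 (hv i)) k)) contDiffOn_const
  · have hV : vInChart v i y = ∑ k, vInChart v i y k • stdE m k := by
      conv_lhs => rw [← (EuclideanSpace.basisFun (Fin (m + 1)) ℝ).sum_repr (vInChart v i y)]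
      simp [stdE]
    rw [inChart_contract v _ hy, inChart_top_eq]
    ext u
    let Λ : EuclideanSpace ℝ (Fin (m + 1)) →ₗ[ℝ] ℝ :=
      { toFun := fun z => interiorAt z μ u
        map_add' := fun z z' => by rw [interiorAt_add]; rfl
        map_smul' := fun c z => by rw [interiorAt_smul]; rfl }
    have hlin : interiorAt (vInChart v i y) μ u =
        ∑ k, vInChart v i y k * interiorAt (stdE m k) μ u := by
      conv_lhs => rw [hV]
      change Λ _ = ∑ k, vInChart v i y k * Λ (stdE m k)
      simp only [map_sum, map_smul, smul_eq_mul]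
    rw [interiorAt_apply, ContinuousAlternatingMap.smul_apply, ← interiorAt_apply,
      ContinuousAlternatingMap.sum_apply]
    refine (congrArg (topCoef (vol o) i y • ·) hlin).trans ?_
    simp only [Finset.mul_sum, smul_eq_mul, ContinuousAlternatingMap.smul_apply, mul_assoc]

end Volume

/-! ### The divergence theorem on the half-space -/

section HalfSpace

variable {m : ℕ}

theorem range_model_eq (m : ℕ) :
    range (𝓡∂ (m + 1)) = {y : EuclideanSpace ℝ (Fin (m + 1)) | 0 ≤ y 0} :=
  range_modelWithCornersEuclideanHalfSpace (m + 1)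

theorem abs_apply_le_norm {n : ℕ} (y : EuclideanSpace ℝ (Fin n)) (j : Fin n) : |y j| ≤ ‖y‖ :=
  PiLp.norm_apply_le y j

theorem bdryIncl_apply_zero (y : EuclideanSpace ℝ (Fin m)) : bdryIncl m y 0 = 0 := rfl

theorem bdryIncl_apply_succ (y : EuclideanSpace ℝ (Fin m)) (j : Fin m) :
    bdryIncl m y j.succ = y j := rfl

/-- The divergence theorem on the half-space, for fields with bounded support. -/
theorem integral_divCoord_halfSpace
    {X : EuclideanSpace ℝ (Fin (m + 1)) → EuclideanSpace ℝ (Fin (m + 1))}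
    (hX : ContDiffOn ℝ ∞ X (range (𝓡∂ (m + 1)))) {R : ℝ} (hR : 0 < R)
    (hsupp : ∀ y ∈ range (𝓡∂ (m + 1)), R ≤ ‖y‖ → X y = 0) :
    ∫ y in range (𝓡∂ (m + 1)), divCoord X y = -∫ y, X (bdryIncl m y) 0 := by
  let H : Set (EuclideanSpace ℝ (Fin (m + 1))) := range (𝓡∂ (m + 1))
  have hH : H = {y | 0 ≤ y 0} := range_model_eq m
  have hHc : IsClosed H := (𝓡∂ (m + 1)).isClosed_range
  let L := (EuclideanSpace.equiv (Fin (m + 1)) ℝ)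
  -- The box `[0, R] × [-R, R]^m`. Its face `y 0 = 0` lies in the boundary hyperplane; on every
  -- other face `‖y‖ ≥ R`, so `X` vanishes there.
  let a : Fin (m + 1) → ℝ := Fin.cons 0 (fun _ => -R)
  let b : Fin (m + 1) → ℝ := fun _ => R
  have hab : a ≤ b := fun j => by
    refine Fin.cases ?_ (fun j => ?_) j
    · exact hR.le
    · change -R ≤ R; linarith
  have hmem : ∀ x ∈ Icc a b, L.symm x ∈ H := fun x hx => by
    rw [hH]
    exact hx.1 0
  have hdX : ContDiffOn ℝ ∞ (fderivWithin ℝ X H) H :=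
    hX.fderivWithin (𝓡∂ (m + 1)).uniqueDiffOn (by simp)
  have hdivc : ContinuousOn (divCoord X) H := by
    refine continuousOn_finsetSum _ fun j _ => ?_
    exact (EuclideanSpace.proj j : _ →L[ℝ] ℝ).continuous.comp_continuousOn
      (hdX.continuousOn.clm_apply continuousOn_const)
  let f' : Fin (m + 1) → (Fin (m + 1) → ℝ) → (Fin (m + 1) → ℝ) →L[ℝ] ℝ := fun j x =>
    (EuclideanSpace.proj j : _ →L[ℝ] ℝ) ∘L (fderivWithin ℝ X H (L.symm x)) ∘L
      (L.symm : (Fin (m + 1) → ℝ) →L[ℝ] EuclideanSpace ℝ (Fin (m + 1)))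
  have hdiv : ∀ x, ∑ j, f' j x (Pi.single j 1) = divCoord X (L.symm x) := fun x => rfl
  have key := integral_divergence_of_hasFDerivAt_off_countable' a b hab
    (fun j x => X (L.symm x) j) f' ∅ countable_empty
    (fun j => (EuclideanSpace.proj j : _ →L[ℝ] ℝ).continuous.comp_continuousOn
      (hX.continuousOn.comp L.symm.continuous.continuousOn hmem))
    (fun x hx j => by
      -- Interior points of the box satisfy `0 < y 0`, so there the derivative within `H` is an
      -- ordinary one.
      have hx0 : H ∈ 𝓝 (L.symm x) := by
        rw [hH]
        have : IsOpen {y : EuclideanSpace ℝ (Fin (m + 1)) | 0 < y 0} :=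
          isOpen_lt continuous_const (EuclideanSpace.proj (0 : Fin (m + 1))).continuous
        exact Filter.mem_of_superset (this.mem_nhds (hx.1 0 (mem_univ _)).1) 
          fun y (hy : 0 < y 0) => show (0 : ℝ) ≤ y 0 from le_of_lt hy
      have h1 : HasFDerivAt X (fderivWithin ℝ X H (L.symm x)) (L.symm x) :=
        ((hX.differentiableOn (by simp)) _ (mem_of_mem_nhds hx0)).hasFDerivWithinAt.hasFDerivAt hx0
      exact (EuclideanSpace.proj j : _ →L[ℝ] ℝ).hasFDerivAt.comp x
        (h1.comp x L.symm.hasFDerivAt))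
    (by
      simp only [hdiv]
      exact (hdivc.comp L.symm.continuous.continuousOn hmem).integrableOn_compact isCompact_Icc)
  simp only [hdiv] at key
  have hfront : ∀ j : Fin (m + 1), ∫ x in Icc (a ∘ j.succAbove) (b ∘ j.succAbove),
      X (L.symm (j.insertNth (b j) x)) j = 0 := fun j => by
    refine setIntegral_eq_zero_of_forall_eq_zero fun x hx => ?_
    rw [hsupp]
    · rfl
    · refine hmem _ ⟨?_, ?_⟩
      · exact (Fin.le_insertNth_iff).2 ⟨hab j, hx.1⟩
      · exact (Fin.insertNth_le_iff).2 ⟨le_rfl, hx.2⟩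
    · refine le_trans ?_ (abs_apply_le_norm _ j)
      change R ≤ |(j.insertNth (b j) x : Fin (m + 1) → ℝ) j|
      rw [Fin.insertNth_apply_same]
      exact le_abs_self R
  have hback : ∀ j : Fin m, ∫ x in Icc (a ∘ j.succ.succAbove) (b ∘ j.succ.succAbove),
      X (L.symm (j.succ.insertNth (a j.succ) x)) j.succ = 0 := fun j => by
    refine setIntegral_eq_zero_of_forall_eq_zero fun x hx => ?_
    rw [hsupp]
    · rfl
    · refine hmem _ ⟨?_, ?_⟩
      · exact (Fin.le_insertNth_iff).2 ⟨le_rfl, hx.1⟩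
      · exact (Fin.insertNth_le_iff).2 ⟨hab j.succ, hx.2⟩
    · refine le_trans ?_ (abs_apply_le_norm _ j.succ)
      change R ≤ |(j.succ.insertNth (a j.succ) x : Fin (m + 1) → ℝ) j.succ|
      rw [Fin.insertNth_apply_same]
      change R ≤ |-R|
      rw [abs_neg]
      exact le_abs_self R
  rw [Fin.sum_univ_succ] at key
  simp only [hfront, hback, sub_zero, Finset.sum_const_zero, add_zero, zero_sub] at key
  -- the left-hand side
  have hmp : MeasurePreserving (fun y : EuclideanSpace ℝ (Fin (m + 1)) => (WithLp.ofLp y)) :=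
    PiLp.volume_preserving_ofLp (Fin (m + 1))
  have hlhs : ∫ y in H, divCoord X y = ∫ x in Icc a b, divCoord X (L.symm x) := by
    have h1 := hmp.setIntegral_preimage_emb
      (MeasurableEquiv.toLp 2 (Fin (m + 1) → ℝ)).symm.measurableEmbedding
      (fun x => divCoord X (L.symm x)) (Icc a b)
    rw [← h1]
    refine setIntegral_eq_of_subset_of_forall_sdiff_eq_zero hHc.measurableSet
      (fun y hy => hmem _ hy) ?_
    rintro y ⟨hyH, hyb⟩
    -- The inequality is strict, hence holds near `y`; so `X` vanishes near `y` in `H`, and its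
    -- divergence at `y` as well.
    have hRy : R < ‖y‖ := by
      by_contra hcon
      refine hyb ⟨fun j => ?_, fun j => ?_⟩
      · refine Fin.cases ?_ (fun j => ?_) j
        · have : y ∈ {y : EuclideanSpace ℝ (Fin (m + 1)) | 0 ≤ y 0} := hH ▸ hyH
          exact this
        · exact (abs_le.1 ((abs_apply_le_norm y j.succ).trans (not_lt.1 hcon))).1
      · exact (abs_le.1 ((abs_apply_le_norm y j).trans (not_lt.1 hcon))).2
    have hev : X =ᶠ[𝓝[H] y] fun _ => 0 := by
      have : ∀ᶠ z in 𝓝[H] y, R < ‖z‖ :=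
        (continuous_norm.continuousAt.eventually (lt_mem_nhds hRy)).filter_mono nhdsWithin_le_nhds
      filter_upwards [this, self_mem_nhdsWithin] with z hz hzH
      exact hsupp z hzH hz.le
    change ∑ j, fderivWithin ℝ X H y (stdE m j) j = 0
    rw [hev.fderivWithin_eq_of_mem hyH]
    simp
  have hmp' : MeasurePreserving (fun y : EuclideanSpace ℝ (Fin m) => (WithLp.ofLp y)) :=
    PiLp.volume_preserving_ofLp (Fin m)
  have hrhs : ∫ y, X (bdryIncl m y) 0 = ∫ x in Icc (a ∘ Fin.succAbove 0) (b ∘ Fin.succAbove 0),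
      X (L.symm (Fin.insertNth 0 (a 0) x)) 0 := by
    have h1 := hmp'.setIntegral_preimage_emb
      (MeasurableEquiv.toLp 2 (Fin m → ℝ)).symm.measurableEmbedding
      (fun x => X (L.symm (Fin.insertNth 0 (a 0) x)) 0)
      (Icc (a ∘ Fin.succAbove 0) (b ∘ Fin.succAbove 0))
    rw [← h1, ← setIntegral_univ]
    have h2 : ∀ y : EuclideanSpace ℝ (Fin m),
        L.symm (Fin.insertNth 0 (a 0) (WithLp.ofLp y)) = bdryIncl m y := fun y => by
      ext j
      refine Fin.cases ?_ (fun j => ?_) j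
      · rw [bdryIncl_apply_zero]
        change (Fin.insertNth 0 (a 0) (WithLp.ofLp y) : Fin (m + 1) → ℝ) 0 = 0
        simp [a]
      · rw [bdryIncl_apply_succ]
        change (Fin.insertNth 0 (a 0) (WithLp.ofLp y) : Fin (m + 1) → ℝ) j.succ = y j
        simp
    simp only [h2]
    refine setIntegral_eq_of_subset_of_forall_sdiff_eq_zero MeasurableSet.univ (subset_univ _) ?_
    rintro y ⟨-, hy⟩
    rw [hsupp]
    · rfl
    · rw [range_model_eq]
      exact (bdryIncl_apply_zero y).ge
    · by_contra hcon
      refine hy ⟨fun j => ?_, fun j => ?_⟩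
      · have := (abs_apply_le_norm (bdryIncl m y) j.succ).trans (not_le.1 hcon).le
        exact (abs_le.1 this).1
      · have := (abs_apply_le_norm (bdryIncl m y) j.succ).trans (not_le.1 hcon).le
        exact (abs_le.1 this).2
  rw [hrhs, ← key]
  exact hlhs

end HalfSpace

/-! ### Integration of top forms and independence of the chart -/

section Integration

variable {m : ℕ} {M : Type*} [TopologicalSpace M] [ChartedSpace (EuclideanHalfSpace (m + 1)) M]
  {i j : M} {y : EuclideanSpace ℝ (Fin (m + 1))}

theorem measurableSet_overlap (i : M) {U : Set M} (hU : IsOpen U) :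
    MeasurableSet ((extChartAt (𝓡∂ (m + 1)) i).target ∩
      (extChartAt (𝓡∂ (m + 1)) i).symm ⁻¹' U) := by
  have hcl : IsClosed (range (𝓡∂ (m + 1))) := (𝓡∂ (m + 1)).isClosed_range
  have h : (extChartAt (𝓡∂ (m + 1)) i).target ∩ (extChartAt (𝓡∂ (m + 1)) i).symm ⁻¹' U =
      (𝓡∂ (m + 1)).symm ⁻¹' ((chartAt (EuclideanHalfSpace (m + 1)) i).target ∩
        (chartAt (EuclideanHalfSpace (m + 1)) i).symm ⁻¹' U) ∩ range (𝓡∂ (m + 1)) := by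
    rw [extChartAt_target]
    ext y
    simp only [mem_inter_iff, mem_preimage, extChartAt_coe_symm, Function.comp]
    tauto
  rw [h]
  exact (((chartAt (EuclideanHalfSpace (m + 1)) i).isOpen_inter_preimage_symm hU).preimage
    (𝓡∂ (m + 1)).continuous_symm).measurableSet.inter hcl.measurableSet

theorem measurableSet_target (i : M) :
    MeasurableSet (extChartAt (𝓡∂ (m + 1)) i).target := by
  simpa using measurableSet_overlap i isOpen_univ

theorem integrableOn_target {f : EuclideanSpace ℝ (Fin (m + 1)) → ℝ}
    {K : Set (EuclideanSpace ℝ (Fin (m + 1)))} (hK : IsCompact K)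
    (hKt : K ⊆ (extChartAt (𝓡∂ (m + 1)) i).target)
    (hf : ContinuousOn f (extChartAt (𝓡∂ (m + 1)) i).target)
    (h0 : ∀ y ∈ (extChartAt (𝓡∂ (m + 1)) i).target \ K, f y = 0) :
    IntegrableOn f (extChartAt (𝓡∂ (m + 1)) i).target :=
  ((hf.mono hKt).integrableOn_compact hK).of_forall_sdiff_eq_zero (measurableSet_target i) h0

/-- Extension by zero of a smooth function on a chart that vanishes off a compact set. -/
theorem contDiffOn_indicator_target {F : Type*} [NormedAddCommGroup F] [NormedSpace ℝ F]
    {f : EuclideanSpace ℝ (Fin (m + 1)) → F}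
    {K : Set (EuclideanSpace ℝ (Fin (m + 1)))} (hK : IsCompact K)
    (hKt : K ⊆ (extChartAt (𝓡∂ (m + 1)) i).target)
    (hf : ContDiffOn ℝ ∞ f (extChartAt (𝓡∂ (m + 1)) i).target)
    (h0 : ∀ y ∈ (extChartAt (𝓡∂ (m + 1)) i).target \ K, f y = 0) :
    ContDiffOn ℝ ∞ ((extChartAt (𝓡∂ (m + 1)) i).target.indicator f) (range (𝓡∂ (m + 1))) := by
  intro y hy
  by_cases hyt : y ∈ (extChartAt (𝓡∂ (m + 1)) i).target
  · refine (hf.contDiffWithinAt_range hyt).congr_of_eventuallyEq ?_ (indicator_of_mem hyt f)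
    filter_upwards [extChartAt_target_mem_nhdsWithin_of_mem hyt] with z hz
    exact indicator_of_mem hz f
  · have hyK : y ∉ K := fun h => hyt (hKt h)
    refine (contDiffWithinAt_const (c := (0 : F))).congr_of_eventuallyEq ?_
      (indicator_of_notMem hyt f)
    filter_upwards [nhdsWithin_le_nhds (hK.isClosed.isOpen_compl.mem_nhds hyK)] with z hz
    by_cases hzt : z ∈ (extChartAt (𝓡∂ (m + 1)) i).target
    · rw [indicator_of_mem hzt, h0 z ⟨hzt, hz⟩]
    · exact indicator_of_notMem hzt f

theorem apply_comp_stdE (b : EuclideanSpace ℝ (Fin (m + 1)) [⋀^Fin (m + 1)]→L[ℝ] ℝ)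
    (L : EuclideanSpace ℝ (Fin (m + 1)) →L[ℝ] EuclideanSpace ℝ (Fin (m + 1))) :
    b.compContinuousLinearMap L (stdE m) = L.det * b (stdE m) := by
  let e := (EuclideanSpace.basisFun (Fin (m + 1)) ℝ).toBasis
  have h1 : b = b (stdE m) • toCont e.det := by
    refine topForm_ext e ?_
    rw [ContinuousAlternatingMap.smul_apply, toCont_apply, Basis.det_self, basisFun_eq_stdE]
    simp
  have h2 : e.det (L ∘ stdE m) = L.det := by
    have := e.det_comp (L : EuclideanSpace ℝ (Fin (m + 1)) →ₗ[ℝ] EuclideanSpace ℝ (Fin (m + 1))) e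
    rw [e.det_self, mul_one, basisFun_eq_stdE] at this
    exact this
  rw [ContinuousAlternatingMap.compContinuousLinearMap_apply]
  conv_lhs => rw [h1, ContinuousAlternatingMap.smul_apply, toCont_apply, h2]
  rw [smul_eq_mul, mul_comm]

variable [RiemannianBundle (fun x : M => TangentSpace (𝓡∂ (m + 1)) x)]
  [IsManifold (𝓡∂ (m + 1)) ∞ M]

/-- The integral of a top form supported in the domains of two charts may be computed in
either of them. -/
theorem integral_target_eq (o : ManifoldOrientation m M) (β : DForm m M (m + 1)) (i j : M)
    (h0 : ∀ x, x ∉ (extChartAt (𝓡∂ (m + 1)) i).source ∩ (extChartAt (𝓡∂ (m + 1)) j).source →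
      β x = 0) :
    ∫ y in (extChartAt (𝓡∂ (m + 1)) i).target, chartSign o.orient i y * topCoef β i y =
      ∫ y in (extChartAt (𝓡∂ (m + 1)) j).target, chartSign o.orient j y * topCoef β j y := by
  -- The form vanishes off the overlap, so both integrals shrink to it, where the change of
  -- variables applies.
  have hred : ∀ i j : M, (∀ x, x ∉ (extChartAt (𝓡∂ (m + 1)) j).source → β x = 0) →
      ∫ y in (extChartAt (𝓡∂ (m + 1)) i).target, chartSign o.orient i y * topCoef β i y =
      ∫ y in (extChartAt (𝓡∂ (m + 1)) i).target ∩ (extChartAt (𝓡∂ (m + 1)) i).symm ⁻¹'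
        (extChartAt (𝓡∂ (m + 1)) j).source, chartSign o.orient i y * topCoef β i y := by
    intro i j h
    refine setIntegral_eq_of_subset_of_forall_sdiff_eq_zero (measurableSet_target i)
      inter_subset_left ?_
    rintro y ⟨hy, hyj⟩
    have : β ((extChartAt (𝓡∂ (m + 1)) i).symm y) = 0 := h _ fun hh => hyj ⟨hy, hh⟩
    rw [topCoef, inChart, this]
    exact mul_zero _
  rw [hred i j fun x hx => h0 x fun hh => hx hh.2, hred j i fun x hx => h0 x fun hh => hx hh.1]
  set A := (extChartAt (𝓡∂ (m + 1)) i).target ∩ (extChartAt (𝓡∂ (m + 1)) i).symm ⁻¹'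
        (extChartAt (𝓡∂ (m + 1)) j).source with hA
  have himg : coordChange i j '' A = (extChartAt (𝓡∂ (m + 1)) j).target ∩
      (extChartAt (𝓡∂ (m + 1)) j).symm ⁻¹' (extChartAt (𝓡∂ (m + 1)) i).source := by
    ext z
    constructor
    · rintro ⟨y, ⟨hy, hyj⟩, rfl⟩
      refine ⟨(extChartAt _ j).map_source hyj, ?_⟩
      rw [mem_preimage, coordChange, Function.comp, (extChartAt _ j).left_inv hyj]
      exact (extChartAt _ i).map_target hy
    · rintro ⟨hz, hzi⟩
      refine ⟨extChartAt (𝓡∂ (m + 1)) i ((extChartAt (𝓡∂ (m + 1)) j).symm z),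
        ⟨(extChartAt _ i).map_source hzi, ?_⟩, ?_⟩
      · rw [mem_preimage, (extChartAt _ i).left_inv hzi]
        exact (extChartAt _ j).map_target hz
      · rw [coordChange, Function.comp, (extChartAt _ i).left_inv hzi,
          (extChartAt _ j).right_inv hz]
  have hinj : InjOn (coordChange i j) A := by
    rintro y ⟨hy, hyj⟩ z ⟨hz, hzj⟩ h
    have h1 := (extChartAt _ j).injOn hyj hzj h
    exact (extChartAt _ i).symm.injOn hy hz h1
  rw [← himg, integral_image_eq_integral_abs_det_fderiv_smul volume
    (measurableSet_overlap i (isOpen_extChartAt_source j))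
    (fun y hy => ((contDiffWithinAt_coordChange hy.1 hy.2).differentiableWithinAt
      (by simp)).hasFDerivWithinAt.mono fun z hz => mem_range_of_mem_target hz.1) hinj]
  refine setIntegral_congr_fun (measurableSet_overlap i (isOpen_extChartAt_source j)) fun y hy => ?_
  have hc : ∀ γ : DForm m M (m + 1), topCoef γ i y =
      (fderivWithin ℝ (coordChange i j) (range (𝓡∂ (m + 1))) y).det *
        topCoef γ j (coordChange i j y) := fun γ => by
    rw [topCoef, inChart_coordChange γ hy.1 hy.2, apply_comp_stdE]
    rfl
  -- The coefficient changes by `det` and the chart sign by `sign det`; together they give the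
  -- Jacobian `|det|`. The charts need not be oriented.
  simp only [chartSign_eq, hc, smul_eq_mul, sign_mul]
  rw [← sign_mul_self]
  push_cast
  ring

end Integration

/-! ### Localization of the divergence theorem by the partition of unity -/

section Stokes

variable {m : ℕ} {M : Type*} [TopologicalSpace M] [ChartedSpace (EuclideanHalfSpace (m + 1)) M]
  {i j : M} {y : EuclideanSpace ℝ (Fin (m + 1))}

/-- A function as a `0`-form. -/
def ofFun (f : M → ℝ) : DForm m M 0 := fun x =>
  ContinuousAlternatingMap.constOfIsEmpty ℝ (TangentSpace (𝓡∂ (m + 1)) x) (Fin 0) (f x)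

@[simp]
theorem fval_ofFun (f : M → ℝ) : fval (ofFun f : DForm m M 0) = f := rfl

/-- The derivative of a function along a vector field. -/
def dAlong (f : M → ℝ) (v : VField m M) (x : M) : ℝ := extD (ofFun f) x (fun _ => v x)

theorem dAlong_eq_zero {f : M → ℝ} {v : VField m M} {x : M}
    (hx : x ∉ tsupport f) : dAlong f v x = 0 := by
  have hy : extChartAt (𝓡∂ (m + 1)) x x ∈ (extChartAt (𝓡∂ (m + 1)) x).target :=
    mem_extChartAt_target x
  have hyr := mem_range_of_mem_target hy
  have hev : fInChart (m := m) f x =ᶠ[𝓝[range (𝓡∂ (m + 1))] (extChartAt (𝓡∂ (m + 1)) x x)]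
      fun _ => 0 := by
    have hc : ContinuousWithinAt (extChartAt (𝓡∂ (m + 1)) x).symm (range (𝓡∂ (m + 1)))
        (extChartAt (𝓡∂ (m + 1)) x x) :=
      ((continuousOn_extChartAt_symm x) _ hy).mono_of_mem_nhdsWithin
        (extChartAt_target_mem_nhdsWithin_of_mem hy)
    have hmem : (tsupport f)ᶜ ∈ 𝓝 ((extChartAt (𝓡∂ (m + 1)) x).symm
        (extChartAt (𝓡∂ (m + 1)) x x)) := by
      rw [extChartAt_to_inv]
      exact (isClosed_tsupport f).isOpen_compl.mem_nhds hx
    filter_upwards [hc hmem] with z hz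
    exact image_eq_zero_of_notMem_tsupport (f := f) hz
  rw [dAlong, extD, extDerivWithin_inChart_zero _ hyr, fval_ofFun, hev.fderivWithin_eq_of_mem hyr]
  simp

variable [IsManifold (𝓡∂ (m + 1)) ∞ M]

theorem isSmooth_ofFun {f : M → ℝ} (hf : ContMDiff (𝓡∂ (m + 1)) 𝓘(ℝ, ℝ) ∞ f) :
    IsSmooth (ofFun f : DForm m M 0) := by
  refine isSmooth_zero_iff.2 fun i => ?_
  exact contMDiffOn_iff_contDiffOn.1 (hf.comp_contMDiffOn (contMDiffOn_extChartAt_symm i))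

theorem fInChart_dAlong {f : M → ℝ} (hf : IsSmooth (ofFun f : DForm m M 0)) (v : VField m M)
    (hy : y ∈ (extChartAt (𝓡∂ (m + 1)) i).target) :
    fInChart (dAlong f v) i y =
      fderivWithin ℝ (fInChart f i) (range (𝓡∂ (m + 1))) y (vInChart v i y) :=
  extD_zero_apply hf v hy

theorem contDiffOn_dAlong {f : M → ℝ} (hf : IsSmooth (ofFun f : DForm m M 0)) {v : VField m M}
    (hv : IsSmoothV v) (i : M) :
    ContDiffOn ℝ ∞ (fInChart (dAlong f v) i) (extChartAt (𝓡∂ (m + 1)) i).target :=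
  ((isSmooth_zero_iff.1 hf i).fderivWithin_range.clm_apply (hv i)).congr fun _ hy =>
    fInChart_dAlong hf v hy

variable [CompactSpace M] [T2Space M]

theorem chartPOU_tsupport_subset (i : M) :
    tsupport (chartPOU m M i) ⊆ (extChartAt (𝓡∂ (m + 1)) i).source := by
  rw [extChartAt_source]
  exact Classical.choose_spec
    (SmoothPartitionOfUnity.exists_isSubordinate_chartAt_source (𝓡∂ (m + 1)) M) i

/-- The coordinate image of the support of a function of the partition of unity. -/
def chartSupp (m : ℕ) {M : Type*} [TopologicalSpace M]
    [ChartedSpace (EuclideanHalfSpace (m + 1)) M] [IsManifold (𝓡∂ (m + 1)) ∞ M] [CompactSpace M]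
    [T2Space M] (i : M) : Set (EuclideanSpace ℝ (Fin (m + 1))) :=
  extChartAt (𝓡∂ (m + 1)) i '' tsupport (chartPOU m M i)

theorem isCompact_chartSupp (i : M) : IsCompact (chartSupp m i) :=
  (isClosed_tsupport _).isCompact.image_of_continuousOn
    ((continuousOn_extChartAt i).mono (chartPOU_tsupport_subset i))

theorem chartSupp_subset (i : M) : chartSupp m i ⊆ (extChartAt (𝓡∂ (m + 1)) i).target := by
  rintro _ ⟨x, hx, rfl⟩
  exact (extChartAt _ i).map_source (chartPOU_tsupport_subset i hx)

theorem symm_notMem_tsupport (hy : y ∈ (extChartAt (𝓡∂ (m + 1)) i).target \ chartSupp m i) :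
    (extChartAt (𝓡∂ (m + 1)) i).symm y ∉ tsupport (chartPOU m M i) := fun h =>
  hy.2 ⟨_, h, (extChartAt _ i).right_inv hy.1⟩

theorem isSmooth_chartPOU (i : M) : IsSmooth (ofFun (chartPOU m M i) : DForm m M 0) :=
  isSmooth_ofFun (chartPOU m M i).contMDiff

/-- The indices of the nonzero functions of the partition of unity. -/
theorem finite_chartPOU (m : ℕ) (M : Type*) [TopologicalSpace M]
    [ChartedSpace (EuclideanHalfSpace (m + 1)) M] [IsManifold (𝓡∂ (m + 1)) ∞ M] [CompactSpace M]
    [T2Space M] : {i : M | (Function.support (chartPOU m M i)).Nonempty}.Finite :=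
  (chartPOU m M).locallyFinite.finite_nonempty_of_compact

/-- The finite set of indices of the nonzero functions of the partition of unity. -/
def chartIdx (m : ℕ) (M : Type*) [TopologicalSpace M]
    [ChartedSpace (EuclideanHalfSpace (m + 1)) M] [IsManifold (𝓡∂ (m + 1)) ∞ M] [CompactSpace M]
    [T2Space M] : Finset M := (finite_chartPOU m M).toFinset

theorem chartPOU_eq_zero (hi : i ∉ chartIdx m M) (x : M) : chartPOU m M i x = 0 := by
  by_contra h
  exact hi ((finite_chartPOU m M).mem_toFinset.2 ⟨x, h⟩)

theorem sum_chartPOU (x : M) : ∑ i ∈ chartIdx m M, chartPOU m M i x = 1 := by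
  rw [← (chartPOU m M).sum_eq_one (mem_univ x)]
  refine (finsum_eq_sum_of_support_subset _ fun i hi => ?_).symm
  by_contra h
  exact hi (chartPOU_eq_zero h x)

/-- The functions sum to the constant `1`, whose differential is zero. -/
theorem sum_dAlong_chartPOU (v : VField m M) (x : M) :
    ∑ i ∈ chartIdx m M, dAlong (chartPOU m M i) v x = 0 := by
  have hy : extChartAt (𝓡∂ (m + 1)) x x ∈ (extChartAt (𝓡∂ (m + 1)) x).target :=
    mem_extChartAt_target x
  have hyr := mem_range_of_mem_target hy
  have h1 : ∀ i : M, dAlong (chartPOU m M i) v x =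
      fderivWithin ℝ (fInChart (chartPOU m M i) x) (range (𝓡∂ (m + 1)))
        (extChartAt (𝓡∂ (m + 1)) x x) (vInChart v x (extChartAt (𝓡∂ (m + 1)) x x)) := fun i => by
    rw [← fInChart_dAlong (isSmooth_chartPOU i) v hy, fInChart, extChartAt_to_inv]
  have h2 : (fun z => ∑ i ∈ chartIdx m M, fInChart (m := m) (chartPOU m M i) x z) = fun _ => 1 :=
    funext fun z => sum_chartPOU _
  have h3 := fderivWithin_fun_sum (𝕜 := ℝ) (u := chartIdx m M)
    (A := fun i => fInChart (m := m) (chartPOU m M i) x)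
    ((𝓡∂ (m + 1)).uniqueDiffOn _ hyr) (fun i _ =>
      ((isSmooth_zero_iff.1 (isSmooth_chartPOU i) x).contDiffWithinAt_range
        hy).differentiableWithinAt (by simp))
  rw [h2] at h3
  simp only [h1]
  rw [← _root_.sum_apply, ← h3]
  simp

variable [RiemannianBundle (fun x : M => TangentSpace (𝓡∂ (m + 1)) x)]
  [IsContMDiffRiemannianBundle (𝓡∂ (m + 1)) ∞ (EuclideanSpace ℝ (Fin (m + 1)))
    (fun x : M => TangentSpace (𝓡∂ (m + 1)) x)]

theorem integrableOn_density (o : ManifoldOrientation m M) {g : M → ℝ}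
    (hg : ContDiffOn ℝ ∞ (fInChart g i) (extChartAt (𝓡∂ (m + 1)) i).target)
    (h0 : ∀ x, x ∉ tsupport (chartPOU m M i) → g x = 0) :
    IntegrableOn (fun y => chartSign o.orient i y * topCoef (density o g) i y)
      (extChartAt (𝓡∂ (m + 1)) i).target := by
  refine integrableOn_target (isCompact_chartSupp i) (chartSupp_subset i)
    ((contDiffOn_chartSign o i).mul (hg.mul (contDiffOn_topCoef_vol o i))).continuousOn ?_
  intro y hy
  rw [topCoef_density, fInChart, h0 _ (symm_notMem_tsupport hy)]
  simp

/-- The theorem of Stokes in one chart. -/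
theorem integral_chart_div (o : ManifoldOrientation m M) {v : VField m M} (hv : IsSmoothV v)
    (i : M) :
    ∫ y in (extChartAt (𝓡∂ (m + 1)) i).target, chartSign o.orient i y *
        fInChart (chartPOU m M i) i y *
          divCoord (fun z => topCoef (vol o) i z • vInChart v i z) y =
      -(∫ y in {y | bdryIncl m y ∈ (extChartAt (𝓡∂ (m + 1)) i).target},
        chartSign o.orient i (bdryIncl m y) * fInChart (chartPOU m M i) i (bdryIncl m y) *
          (topCoef (vol o) i (bdryIncl m y) * vInChart v i (bdryIncl m y) 0)) -
      ∫ y in (extChartAt (𝓡∂ (m + 1)) i).target, chartSign o.orient i y *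
        topCoef (density o (dAlong (chartPOU m M i) v)) i y := by
  set U := (extChartAt (𝓡∂ (m + 1)) i).target with hU
  set s := chartSign o.orient i
  set ρ : EuclideanSpace ℝ (Fin (m + 1)) → ℝ := fInChart (chartPOU m M i) i with hρ
  set W : EuclideanSpace ℝ (Fin (m + 1)) → EuclideanSpace ℝ (Fin (m + 1)) :=
    fun z => topCoef (vol o) i z • vInChart v i z with hW
  have hs : ContDiffOn ℝ ∞ s U := contDiffOn_chartSign o i
  have hρs : ContDiffOn ℝ ∞ ρ U := isSmooth_zero_iff.1 (isSmooth_chartPOU i) i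
  have hWs : ContDiffOn ℝ ∞ W U := (contDiffOn_topCoef_vol o i).smul (hv i)
  -- Extended by zero, this field is smooth on the half-space with bounded support. Its divergence
  -- is `s ρ div W` plus the term in `dρ`; the sign `s` is locally constant and is not
  -- differentiated.
  let G₀ : EuclideanSpace ℝ (Fin (m + 1)) → EuclideanSpace ℝ (Fin (m + 1)) :=
    fun z => (s z * ρ z) • W z
  have hρ0 : ∀ y ∈ U \ chartSupp m i, ρ y = 0 := fun y hy =>
    image_eq_zero_of_notMem_tsupport (f := chartPOU m M i) (symm_notMem_tsupport hy)
  have hG0 : ∀ y ∈ U \ chartSupp m i, G₀ y = 0 := fun y hy => by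
    simp only [G₀, hρ0 y hy, mul_zero, zero_smul]
  have hG : ContDiffOn ℝ ∞ (U.indicator G₀) (range (𝓡∂ (m + 1))) :=
    contDiffOn_indicator_target (isCompact_chartSupp i) (chartSupp_subset i)
      ((hs.mul hρs).smul hWs) hG0
  have hGK : ∀ y, y ∉ chartSupp m i → U.indicator G₀ y = 0 := fun y hy => by
    by_cases hyU : y ∈ U
    · rw [indicator_of_mem hyU, hG0 y ⟨hyU, hy⟩]
    · exact indicator_of_notMem hyU _
  obtain ⟨R, hR, hRK⟩ := (isCompact_chartSupp (m := m) i).isBounded.subset_ball_lt 0 0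
  have hdiv := integral_divCoord_halfSpace hG hR fun y _ hy => hGK y fun hyK => by
    have := hRK hyK
    rw [mem_ball_zero_iff] at this
    linarith
  -- the divergence of the localized field
  have hin : ∀ y ∈ U, divCoord (U.indicator G₀) y = s y * ρ y * divCoord W y +
      s y * topCoef (density o (dAlong (chartPOU m M i) v)) i y := by
    intro y hy
    have hyr := mem_range_of_mem_target hy
    have hev : U.indicator G₀ =ᶠ[𝓝[range (𝓡∂ (m + 1))] y] fun z => (s y * ρ z) • W z := by
      have h1 := eventually_chartSign_eq o hy
      rw [nhdsWithin_extChartAt_target_eq_of_mem hy] at h1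
      filter_upwards [h1, extChartAt_target_mem_nhdsWithin_of_mem hy] with z hz hzU
      rw [indicator_of_mem hzU]
      simp only [G₀, s, hz]
    have hd : DifferentiableWithinAt ℝ ρ (range (𝓡∂ (m + 1))) y :=
      (hρs.contDiffWithinAt_range hy).differentiableWithinAt (by simp)
    have h2 : divCoord (U.indicator G₀) y = divCoord (fun z => (s y * ρ z) • W z) y := by
      rw [divCoord, divCoord, hev.fderivWithin_eq_of_mem hyr]
    rw [h2, divCoord_smul hyr (hd.const_mul (s y))
      ((hWs.contDiffWithinAt_range hy).differentiableWithinAt (by simp)),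
      fderivWithin_const_mul ((𝓡∂ (m + 1)).uniqueDiffOn y hyr) hd, topCoef_density,
      fInChart_dAlong (isSmooth_chartPOU i) v hy]
    simp only [hW, _root_.smul_apply, map_smul, smul_eq_mul]
    ring
  have hout : ∀ y ∈ range (𝓡∂ (m + 1)) \ U, divCoord (U.indicator G₀) y = 0 := by
    rintro y ⟨hyr, hyU⟩
    have hev : U.indicator G₀ =ᶠ[𝓝[range (𝓡∂ (m + 1))] y] fun _ => 0 := by
      have hyK : y ∉ chartSupp m i := fun h => hyU (chartSupp_subset i h)
      filter_upwards [nhdsWithin_le_nhds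
        ((isCompact_chartSupp i).isClosed.isOpen_compl.mem_nhds hyK)] with z hz
      exact hGK z hz
    rw [divCoord, hev.fderivWithin_eq_of_mem hyr]
    simp
  have hmeas : MeasurableSet U := measurableSet_target i
  have hHm : MeasurableSet (range (𝓡∂ (m + 1))) := (𝓡∂ (m + 1)).isClosed_range.measurableSet
  rw [setIntegral_eq_of_subset_of_forall_sdiff_eq_zero hHm (extChartAt_target_subset_range i) hout,
    setIntegral_congr_fun hmeas hin, integral_add] at hdiv
  · rw [eq_sub_iff_add_eq, hdiv]
    congr 1
    have hb : MeasurableSet {y : EuclideanSpace ℝ (Fin m) | bdryIncl m y ∈ U} :=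
      (bdryIncl m).continuous.measurable hmeas
    rw [← integral_indicator hb]
    refine integral_congr_ae (Eventually.of_forall fun y => ?_)
    by_cases hy : bdryIncl m y ∈ U
    · simp only [indicator_of_mem hy]
      rw [indicator_of_mem (show y ∈ {y : EuclideanSpace ℝ (Fin m) | bdryIncl m y ∈ U} from hy)]
      rfl
    · simp only [indicator_of_notMem hy]
      rw [indicator_of_notMem (show y ∉ {y : EuclideanSpace ℝ (Fin m) | bdryIncl m y ∈ U} from hy)]
      rfl
  · refine integrableOn_target (isCompact_chartSupp i) (chartSupp_subset i) ?_ ?_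
    · refine (hs.mul hρs).continuousOn.mul ?_
      refine continuousOn_finsetSum _ fun j _ => ?_
      exact (EuclideanSpace.proj j : _ →L[ℝ] ℝ).continuous.comp_continuousOn
        (hWs.fderivWithin_range.continuousOn.clm_apply continuousOn_const)
    · intro y hy
      simp only [hρ0 y hy, mul_zero, zero_mul]
  · exact integrableOn_density o (contDiffOn_dAlong (isSmooth_chartPOU i) hv i)
      fun x hx => dAlong_eq_zero hx

/-- Pointwise the `dρ_i(v)` cancel, but the `i`-th integral is taken in the chart at `i`. Inserting
`1 = ∑ ρ_j` gives terms `ρ_j dρ_i(v)` supported in both charts, which `integral_target_eq` moves to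
the chart at `j`. For fixed `j` all terms are then in one chart, and the sum over `i` vanishes. -/
theorem sum_integral_dAlong (o : ManifoldOrientation m M) {v : VField m M} (hv : IsSmoothV v) :
    ∑ i ∈ chartIdx m M, ∫ y in (extChartAt (𝓡∂ (m + 1)) i).target, chartSign o.orient i y *
        topCoef (density o (dAlong (chartPOU m M i) v)) i y = 0 := by
  have hprod : ∀ i j k : M, ContDiffOn ℝ ∞ (fInChart (fun x => chartPOU m M j x *
      dAlong (chartPOU m M i) v x) k) (extChartAt (𝓡∂ (m + 1)) k).target := fun i j k =>
    (isSmooth_zero_iff.1 (isSmooth_chartPOU j) k).mul (contDiffOn_dAlong (isSmooth_chartPOU i) hv k)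
  have h1 : ∀ i : M, ∫ y in (extChartAt (𝓡∂ (m + 1)) i).target, chartSign o.orient i y *
        topCoef (density o (dAlong (chartPOU m M i) v)) i y =
      ∑ j ∈ chartIdx m M, ∫ y in (extChartAt (𝓡∂ (m + 1)) j).target, chartSign o.orient j y *
        topCoef (density o (fun x => chartPOU m M j x * dAlong (chartPOU m M i) v x)) j y := by
    intro i
    have h2 : ∀ j : M, ∫ y in (extChartAt (𝓡∂ (m + 1)) j).target, chartSign o.orient j y *
          topCoef (density o (fun x => chartPOU m M j x * dAlong (chartPOU m M i) v x)) j y =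
        ∫ y in (extChartAt (𝓡∂ (m + 1)) i).target, chartSign o.orient i y *
          topCoef (density o (fun x => chartPOU m M j x * dAlong (chartPOU m M i) v x)) i y := by
      intro j
      refine integral_target_eq o _ j i fun x hx => ?_
      have : chartPOU m M j x * dAlong (chartPOU m M i) v x = 0 := by
        by_contra hne
        refine hx ⟨chartPOU_tsupport_subset j ?_, chartPOU_tsupport_subset i ?_⟩
        · by_contra hj
          exact hne (by rw [image_eq_zero_of_notMem_tsupport hj, zero_mul])
        · by_contra hi
          exact hne (by rw [dAlong_eq_zero hi, mul_zero])
      rw [density, this, zero_smul]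
    rw [Finset.sum_congr rfl fun j _ => h2 j, ← integral_finsetSum]
    · refine setIntegral_congr_fun (measurableSet_target i) fun y _ => ?_
      simp only [topCoef_density, fInChart]
      rw [← Finset.mul_sum, ← Finset.sum_mul, ← Finset.sum_mul, sum_chartPOU, one_mul]
    · intro j _
      exact integrableOn_density o (hprod i j i) fun x hx => by rw [dAlong_eq_zero hx, mul_zero]
  rw [Finset.sum_congr rfl fun i _ => h1 i, Finset.sum_comm]
  refine Finset.sum_eq_zero fun j _ => ?_
  rw [← integral_finsetSum]
  · refine setIntegral_eq_zero_of_forall_eq_zero fun y _ => ?_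
    simp only [topCoef_density, fInChart]
    rw [← Finset.mul_sum, ← Finset.sum_mul, ← Finset.mul_sum, sum_dAlong_chartPOU]
    simp
  · intro i _
    exact integrableOn_density o (hprod i j j) fun x hx => by
      rw [image_eq_zero_of_notMem_tsupport hx, zero_mul]

end Stokes

/-! ### Boundary flux, the divergence theorem on `M` and the two duality formulas -/

section Duality

variable {m : ℕ} {M : Type*} [TopologicalSpace M] [ChartedSpace (EuclideanHalfSpace (m + 1)) M]
  {i j : M} {y : EuclideanSpace ℝ (Fin (m + 1))}

theorem stdE_succ (j : Fin m) : bdryIncl m (EuclideanSpace.single j 1) = stdE m j.succ := by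
  ext k
  refine Fin.cases ?_ (fun k => ?_) k
  · rw [bdryIncl_apply_zero]
    simp [stdE]
  · rw [bdryIncl_apply_succ]
    simp [stdE, Fin.succ_inj]

theorem cons_bdryIncl (u : EuclideanSpace ℝ (Fin (m + 1))) :
    (Fin.cons u (fun j => bdryIncl m (EuclideanSpace.single j 1)) :
      Fin (m + 1) → EuclideanSpace ℝ (Fin (m + 1))) = Function.update (stdE m) 0 u := by
  funext k
  refine Fin.cases ?_ (fun k => ?_) k
  · simp
  · simp [stdE_succ]

theorem IsSmoothV.smul {v : VField m M} (hv : IsSmoothV v) {g : M → ℝ}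
    (hg : ∀ i : M, ContDiffOn ℝ ∞ (fInChart g i) (extChartAt (𝓡∂ (m + 1)) i).target) :
    IsSmoothV (fun x => g x • v x) := fun i =>
  ((hg i).smul (hv i)).congr fun _ _ => map_smul _ _ _

theorem contDiffOn_oneForm_apply [IsManifold (𝓡∂ (m + 1)) ∞ M] {α : DForm m M 1}
    (hα : IsSmooth α) {v : VField m M}
    (hv : IsSmoothV v) (i : M) :
    ContDiffOn ℝ ∞ (fInChart (fun x => α x (fun _ => v x)) i)
      (extChartAt (𝓡∂ (m + 1)) i).target := by
  have h1 := (ContinuousAlternatingMap.ofSubsingletonLIE (𝕜 := ℝ)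
    (E := EuclideanSpace ℝ (Fin (m + 1))) (F := ℝ) (0 : Fin 1)).symm.contDiff.comp_contDiffOn
      (hα i)
  refine (h1.clm_apply (hv i)).congr fun y hy => ?_
  change α _ _ = α _ (fun _ => dChartSymm i y (vInChart v i y))
  rw [dChartSymm_vInChart v hy]

variable [RiemannianBundle (fun x : M => TangentSpace (𝓡∂ (m + 1)) x)]

/-- The outward normal is `-∂_0`, which reverses the coordinate frame. This sign cancels the one in
`integral_divCoord_halfSpace`. -/
theorem bdrySign_eq (o : ManifoldOrientation m M) (i : M) (y : EuclideanSpace ℝ (Fin m)) :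
    bdrySign o i y = -chartSign o.orient i (bdryIncl m y) := by
  rw [bdrySign, cons_bdryIncl, apply_update_stdE, chartSign_eq]
  have : (-EuclideanSpace.single 0 1 : EuclideanSpace ℝ (Fin (m + 1))) 0 = -1 := by simp
  rw [this, neg_one_mul, Left.sign_neg]
  simp [topCoef]

variable [IsManifold (𝓡∂ (m + 1)) ∞ M]

/-- With `ω = ι_v vol` the trace is `vol (v, ∂_1, …, ∂_m)`, in which only the normal component of
`v` survives: the trace is a flux. -/
theorem traceInChart_eq (o : ManifoldOrientation m M) (w : DForm m M m)
    {y : EuclideanSpace ℝ (Fin m)} (hy : bdryIncl m y ∈ (extChartAt (𝓡∂ (m + 1)) i).target) :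
    traceInChart w i y (fun j => EuclideanSpace.single j 1) =
      topCoef (vol o) i (bdryIncl m y) * vInChart (hat o w) i (bdryIncl m y) 0 := by
  rw [traceInChart, ContinuousAlternatingMap.compContinuousLinearMap_apply]
  conv_lhs => rw [← contract_hat o w, inChart_contract _ _ hy, interiorAt_apply]
  rw [mul_comm]
  exact (congrArg _ (cons_bdryIncl _)).trans (apply_update_stdE _ _ _)

theorem isSmooth_wedge_one [IsContMDiffRiemannianBundle (𝓡∂ (m + 1)) ∞
    (EuclideanSpace ℝ (Fin (m + 1))) (fun x : M => TangentSpace (𝓡∂ (m + 1)) x)]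
    (h : 1 + m = m + 1) (o : ManifoldOrientation m M) {α : DForm m M 1}
    (hα : IsSmooth α) {w : DForm m M m} (hw : IsSmooth w) : IsSmooth (wedge h α w) := by
  rw [wedge_one h o]
  exact isSmooth_density o (contDiffOn_oneForm_apply hα (isSmoothV_hat o hw))

variable [CompactSpace M] [T2Space M]

theorem integralM_eq_sum (o : ManifoldOrientation m M) (β : DForm m M (m + 1)) :
    integralM o β = ∑ i ∈ chartIdx m M, ∫ y in (extChartAt (𝓡∂ (m + 1)) i).target,
      chartSign o.orient i y * fInChart (chartPOU m M i) i y * topCoef β i y := by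
  refine finsum_eq_sum_of_support_subset _ fun i hi => ?_
  by_contra h
  refine hi (setIntegral_eq_zero_of_forall_eq_zero fun y _ => ?_)
  rw [chartPOU_eq_zero h]
  simp

theorem integralBdry_eq_sum (o : ManifoldOrientation m M) (η : DForm m M m) :
    integralBdry o η = ∑ i ∈ chartIdx m M,
      ∫ y in {y | bdryIncl m y ∈ (extChartAt (𝓡∂ (m + 1)) i).target},
        bdrySign o i y * fInChart (chartPOU m M i) i (bdryIncl m y) *
          traceInChart η i y (fun j => EuclideanSpace.single j 1) := by
  refine finsum_eq_sum_of_support_subset _ fun i hi => ?_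
  by_contra h
  refine hi (setIntegral_eq_zero_of_forall_eq_zero fun y _ => ?_)
  rw [chartPOU_eq_zero h]
  simp

theorem integrableOn_chartPOU_mul (o : ManifoldOrientation m M)
    {h : EuclideanSpace ℝ (Fin (m + 1)) → ℝ}
    (hh : ContinuousOn h (extChartAt (𝓡∂ (m + 1)) i).target) :
    IntegrableOn (fun y => chartSign o.orient i y * fInChart (chartPOU m M i) i y * h y)
      (extChartAt (𝓡∂ (m + 1)) i).target := by
  refine integrableOn_target (isCompact_chartSupp i) (chartSupp_subset i)
    (((contDiffOn_chartSign o i).mul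
      (isSmooth_zero_iff.1 (isSmooth_chartPOU i) i)).continuousOn.mul hh) ?_
  intro y hy
  have : fInChart (chartPOU m M i) i y = 0 :=
    image_eq_zero_of_notMem_tsupport (f := chartPOU m M i) (symm_notMem_tsupport hy)
  simp [this]

theorem integralM_sub (o : ManifoldOrientation m M) {β γ : DForm m M (m + 1)}
    (hβ : IsSmooth β) (hγ : IsSmooth γ) :
    integralM o β - integralM o γ = ∑ i ∈ chartIdx m M,
      ∫ y in (extChartAt (𝓡∂ (m + 1)) i).target, chartSign o.orient i y *
        fInChart (chartPOU m M i) i y * (topCoef β i y - topCoef γ i y) := by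
  rw [integralM_eq_sum, integralM_eq_sum, ← Finset.sum_sub_distrib]
  refine Finset.sum_congr rfl fun i _ => ?_
  rw [← integral_sub]
  · simp only [mul_sub]
  · exact integrableOn_chartPOU_mul o (isSmooth_top_iff.1 hβ i).continuousOn
  · exact integrableOn_chartPOU_mul o (isSmooth_top_iff.1 hγ i).continuousOn

/-- Both integrands are the density `(*b) da(ω̂)`; being equal as forms, they leave no boundary
term. -/
theorem pairing_lieD_zero (o : ManifoldOrientation m M) (a : DForm m M 0)
    (w : DForm m M m) (b : DForm m M (m + 1)) :
    pairing (Nat.add_comm 1 m) o (fsmul (star (Nat.zero_add (m + 1)) o b) (extD a)) w =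
      pairing (Nat.add_zero (m + 1)) o b (interconnection o a w) := by
  rw [pairing, pairing, wedge_zero_right, wedge_one _ o]
  conv_rhs => rw [← density_star (Nat.zero_add (m + 1)) o b]
  rw [fsmul_eq_density]
  congr 2
  funext x
  rw [mul_comm, interconnection, show fval (lieD (hat o w) a) x = _ from lieD_zero _ _ _]
  rfl

variable [IsContMDiffRiemannianBundle (𝓡∂ (m + 1)) ∞ (EuclideanSpace ℝ (Fin (m + 1)))
    (fun x : M => TangentSpace (𝓡∂ (m + 1)) x)]

/-- The divergence theorem: the integral of the divergence of `v` is the flux of `v` through the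
boundary. -/
theorem sum_integral_div (o : ManifoldOrientation m M) {v : VField m M} (hv : IsSmoothV v) :
    ∑ i ∈ chartIdx m M, ∫ y in (extChartAt (𝓡∂ (m + 1)) i).target, chartSign o.orient i y *
        fInChart (chartPOU m M i) i y *
          divCoord (fun z => topCoef (vol o) i z • vInChart v i z) y =
      integralBdry o (contract v (vol o)) := by
  rw [Finset.sum_congr rfl fun i _ => integral_chart_div o hv i, Finset.sum_sub_distrib,
    sum_integral_dAlong o hv, sub_zero, integralBdry_eq_sum]
  refine Finset.sum_congr rfl fun i _ => ?_
  rw [← integral_neg]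
  refine setIntegral_congr_fun ((bdryIncl m).continuous.measurable (measurableSet_target i))
    fun y hy => ?_
  simp only [bdrySign_eq, traceInChart_eq o _ hy, hat_contract]
  ring

/-- Integration by parts for the Lie derivative of a top form. -/
theorem pairing_lieD_top (o : ManifoldOrientation m M) {a : DForm m M (m + 1)} (ha : IsSmooth a)
    {w : DForm m M m} (hw : IsSmooth w) {b : DForm m M 0} (hb : IsSmooth b) :
    pairing (Nat.add_comm 1 m) o (-fsmul (star (Nat.zero_add (m + 1)) o a) (extD b)) w =
      pairing (Nat.zero_add (m + 1)) o b (interconnection o a w) +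
        integralBdry o (-wedge (Nat.add_zero m)
          (fsmul (star (Nat.zero_add (m + 1)) o a) w) b) := by
  set f := star (Nat.zero_add (m + 1)) o a with hf
  have hfs : IsSmooth f := isSmooth_star _ o ha
  have hv := isSmoothV_hat o hw
  set v := hat o w with hvdef
  have hg : ∀ i : M, ContDiffOn ℝ ∞ (fInChart (fun x => -(fval b x * fval f x)) i)
      (extChartAt (𝓡∂ (m + 1)) i).target := fun i =>
    ((isSmooth_zero_iff.1 hb i).mul (isSmooth_zero_iff.1 hfs i)).neg
  have hX := hv.smul hg
  -- The surface term is the flux form of the field `-b f v`, so what remains is to match its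
  -- divergence with the difference of the integrands.
  have hη : -wedge (Nat.add_zero m) (fsmul f w) b =
      contract (fun x => (-(fval b x * fval f x)) • v x) (vol o) := by
    rw [wedge_zero_right]
    funext x
    rw [contract, interiorAt_smul, interiorAt_hat]
    ext u
    change -(fval b x * (fval f x * w x u)) = (-(fval b x * fval f x)) * w x u
    ring
  rw [hη, ← sum_integral_div o hX, ← sub_eq_iff_eq_add', pairing, pairing, integralM_sub o
    (isSmooth_wedge_one _ o (hfs.fsmul hb.extD_zero).neg hw)
    (by rw [wedge_zero_left]; exact hb.fsmul (IsSmooth.lieD_top hv ha))]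
  refine Finset.sum_congr rfl fun i _ => ?_
  refine setIntegral_congr_fun (measurableSet_target i) fun y hy => ?_
  have hyr := mem_range_of_mem_target hy
  have hbd : DifferentiableWithinAt ℝ (fInChart (fval b) i) (range (𝓡∂ (m + 1))) y :=
    ((isSmooth_zero_iff.1 hb i).contDiffWithinAt_range hy).differentiableWithinAt (by simp)
  have hAV : DifferentiableWithinAt ℝ (fun z => topCoef a i z • vInChart v i z)
      (range (𝓡∂ (m + 1))) y :=
    (((isSmooth_top_iff.1 ha i).smul (hv i)).contDiffWithinAt_range
      hy).differentiableWithinAt (by simp)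
  have hA : ∀ z, topCoef a i z = fInChart (fval f) i z * topCoef (vol o) i z := fun z => by
    rw [← topCoef_density, hf, density_star]
  -- The factor `f` is absorbed into the coefficient `A` of `a`: the field reads `-b (A X)`, and one
  -- use of Leibniz isolates `div (A X)`, the coefficient of `L_v a`.
  have hfun : (fun z => topCoef (vol o) i z •
      vInChart (fun x => (-(fval b x * fval f x)) • v x) i z) =
      fun z => (-fInChart (fval b) i z) • (topCoef a i z • vInChart v i z) := by
    funext z
    have : vInChart (fun x => (-(fval b x * fval f x)) • v x) i z =
        (-(fInChart (fval b) i z * fInChart (fval f) i z)) • vInChart v i z := map_smul _ _ _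
    rw [this, hA, smul_smul, smul_smul]
    congr 1
    ring
  have h1 : topCoef (wedge (Nat.add_comm 1 m) (-fsmul f (extD b)) w) i y =
      -(fInChart (fval f) i y * fderivWithin ℝ (fInChart (fval b) i) (range (𝓡∂ (m + 1))) y
        (vInChart v i y)) * topCoef (vol o) i y := by
    rw [wedge_one _ o, topCoef_density, ← extD_zero_apply hb v hy]
    rfl
  have h2 : topCoef (wedge (Nat.zero_add (m + 1)) b (interconnection o a w)) i y =
      fInChart (fval b) i y * divCoord (fun z => topCoef a i z • vInChart v i z) y := by
    rw [wedge_zero_left, topCoef_fsmul, interconnection, topCoef_lieD hv ha hy]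
  simp only [h1, h2, hfun]
  rw [divCoord_smul hyr (f := fun z => -fInChart (fval b) i z) hbd.neg hAV,
    fderivWithin_fun_neg ((𝓡∂ (m + 1)).uniqueDiffOn y hyr)]
  simp only [_root_.neg_apply, map_smul, smul_eq_mul, hA]
  ring

end Duality

/-! ### Test forms supported in the interior and uniqueness of the formal dual -/

section Uniqueness

variable {m : ℕ} {M : Type*} [TopologicalSpace M] [ChartedSpace (EuclideanHalfSpace (m + 1)) M]
  {i c : M} {y : EuclideanSpace ℝ (Fin (m + 1))}

theorem mem_interior_target (hy : y ∈ (extChartAt (𝓡∂ (m + 1)) i).target)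
    (hyi : y ∈ interior (range (𝓡∂ (m + 1)))) :
    y ∈ interior (extChartAt (𝓡∂ (m + 1)) i).target := by
  rw [mem_interior_iff_mem_nhds] at hyi ⊢
  have := extChartAt_target_mem_nhdsWithin_of_mem hy
  rwa [nhdsWithin_eq_nhds.2 hyi] at this

theorem IsSmooth.sub {k : ℕ} {α β : DForm m M k} (hα : IsSmooth α) (hβ : IsSmooth β) :
    IsSmooth (α - β) := fun i => (hα i).sub (hβ i)

theorem chartSign_mul_topCoef_vol [RiemannianBundle (fun x : M => TangentSpace (𝓡∂ (m + 1)) x)]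
    (o : ManifoldOrientation m M) (i : M) (y : EuclideanSpace ℝ (Fin (m + 1))) :
    chartSign o.orient i y * topCoef (vol o) i y = |topCoef (vol o) i y| := by
  rw [chartSign_eq, sign_mul_self]

variable [IsManifold (𝓡∂ (m + 1)) ∞ M]

theorem isInteriorPoint_symm_iff (hy : y ∈ (extChartAt (𝓡∂ (m + 1)) i).target) :
    (extChartAt (𝓡∂ (m + 1)) i).symm y ∈ (𝓡∂ (m + 1)).interior M ↔
      y ∈ interior (extChartAt (𝓡∂ (m + 1)) i).target := by
  have hx : (extChartAt (𝓡∂ (m + 1)) i).symm y ∈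
      (chartAt (EuclideanHalfSpace (m + 1)) i).source := by
    rw [← extChartAt_source (𝓡∂ (m + 1))]
    exact (extChartAt _ i).map_target hy
  have h := (𝓡∂ (m + 1)).isInteriorPoint_iff_of_mem_atlas (n := ∞) (by simp)
    (chart_mem_atlas (EuclideanHalfSpace (m + 1)) i) hx
  have h2 : (chartAt (EuclideanHalfSpace (m + 1)) i).extend (𝓡∂ (m + 1))
      ((extChartAt (𝓡∂ (m + 1)) i).symm y) = y := (extChartAt (𝓡∂ (m + 1)) i).right_inv hy
  rw [h2] at h
  exact h

/-- A vector field supported in the domain of a chart is smooth if it is smooth in that chart. -/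
theorem isSmoothV_of_chart {v : VField m M} {S : Set M} (hS : IsClosed S)
    (hSc : S ⊆ (extChartAt (𝓡∂ (m + 1)) c).source) (h0 : ∀ x, x ∉ S → v x = 0)
    (hv : ContDiffOn ℝ ∞ (vInChart v c) (extChartAt (𝓡∂ (m + 1)) c).target) : IsSmoothV v := by
  intro i y hy
  have hyr := mem_range_of_mem_target hy
  refine ContDiffWithinAt.mono ?_ (extChartAt_target_subset_range i)
  by_cases hyc : (extChartAt (𝓡∂ (m + 1)) i).symm y ∈ (extChartAt (𝓡∂ (m + 1)) c).source
  · set y' := coordChange i c y with hy'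
    have hy't : y' ∈ (extChartAt (𝓡∂ (m + 1)) c).target := (extChartAt _ c).map_source hyc
    have hsymm : ∀ z, (extChartAt (𝓡∂ (m + 1)) i).symm z ∈ (extChartAt (𝓡∂ (m + 1)) c).source →
        (extChartAt (𝓡∂ (m + 1)) c).symm (coordChange i c z) =
          (extChartAt (𝓡∂ (m + 1)) i).symm z := fun z hz => (extChartAt _ c).left_inv hz
    have hy'i : (extChartAt (𝓡∂ (m + 1)) c).symm y' ∈ (extChartAt (𝓡∂ (m + 1)) i).source := by
      rw [hy', hsymm y hyc]
      exact (extChartAt _ i).map_target hy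
    have hcc := contDiffWithinAt_coordChange hy hyc
    -- On the overlap the components in the chart at `i` are the derivative of the change from `c`
    -- to `i` applied to those in the chart at `c`.
    have h1 : ContDiffWithinAt ℝ ∞ (fderivWithin ℝ (coordChange c i) (range (𝓡∂ (m + 1))))
        (range (𝓡∂ (m + 1))) y' :=
      (contDiffWithinAt_coordChange hy't hy'i).fderivWithin_right (𝓡∂ (m + 1)).uniqueDiffOn
        (by simp) (mem_range_of_mem_target hy't)
    have h2 := (h1.clm_apply (hv.contDiffWithinAt_range hy't)).comp y hcc
      (mapsTo_coordChange i c _)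
    refine h2.congr_of_eventuallyEq_of_mem ?_ hyr
    filter_upwards [eventually_mem_overlap hy hyc] with z hz
    have hzt : coordChange i c z ∈ (extChartAt (𝓡∂ (m + 1)) c).target :=
      (extChartAt _ c).map_source hz.2
    have hzi : (extChartAt (𝓡∂ (m + 1)) c).symm (coordChange i c z) ∈
        (extChartAt (𝓡∂ (m + 1)) i).source := by
      rw [hsymm z hz.2]
      exact (extChartAt _ i).map_target hz.1
    have h3 := vInChart_coordChange v hzt hzi
    have h4 : coordChange c i (coordChange i c z) = z := by
      rw [coordChange, Function.comp, hsymm z hz.2, (extChartAt _ i).right_inv hz.1]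
    rw [h4] at h3
    exact h3
  · have hyS : (extChartAt (𝓡∂ (m + 1)) i).symm y ∉ S := fun h => hyc (hSc h)
    have hc : ContinuousWithinAt (extChartAt (𝓡∂ (m + 1)) i).symm (range (𝓡∂ (m + 1))) y :=
      ((continuousOn_extChartAt_symm i) y hy).mono_of_mem_nhdsWithin
        (extChartAt_target_mem_nhdsWithin_of_mem hy)
    refine (contDiffWithinAt_const (c := 0)).congr_of_eventuallyEq_of_mem ?_ hyr
    filter_upwards [hc (hS.isOpen_compl.mem_nhds hyS)] with z hz
    rw [vInChart, h0 _ hz, map_zero]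

/-- The gradient, in the coordinates of the chart at `c`, of a `1`-form. -/
def chartGrad (γ : DForm m M 1) (c : M) (y : EuclideanSpace ℝ (Fin (m + 1))) :
    EuclideanSpace ℝ (Fin (m + 1)) :=
  ∑ k, inChart γ c y (fun _ => stdE m k) • stdE m k

/-- The vector field `χ • grad γ`. -/
def bumpField (γ : DForm m M 1) (c : M) (χ : M → ℝ) : VField m M := fun x =>
  χ x • (dChart c x).inverse (chartGrad γ c (extChartAt (𝓡∂ (m + 1)) c x))

theorem dChart_bumpField (γ : DForm m M 1) (χ : M → ℝ) {x : M}
    (hx : x ∈ (extChartAt (𝓡∂ (m + 1)) c).source) :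
    dChart c x (bumpField γ c χ x) =
      χ x • chartGrad γ c (extChartAt (𝓡∂ (m + 1)) c x) := by
  have hinv : (dChart c x).IsInvertible := isInvertible_mfderiv_extChartAt hx
  rw [bumpField, map_smul, hinv.self_apply_inverse]

theorem isSmoothV_bumpField {γ : DForm m M 1} (hγ : IsSmooth γ) {χ : M → ℝ}
    (hχ : IsSmooth (ofFun χ : DForm m M 0))
    (hχs : tsupport χ ⊆ (extChartAt (𝓡∂ (m + 1)) c).source) :
    IsSmoothV (bumpField γ c χ) := by
  refine isSmoothV_of_chart (isClosed_tsupport χ) hχs (fun x hx => ?_) ?_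
  · rw [bumpField, image_eq_zero_of_notMem_tsupport hx, zero_smul]
  · have h1 : ContDiffOn ℝ ∞ (chartGrad γ c) (extChartAt (𝓡∂ (m + 1)) c).target :=
      ContDiffOn.sum fun k _ => (contDiffOn_apply (hγ c) _).smul contDiffOn_const
    refine ((isSmooth_zero_iff.1 hχ c).smul h1).congr fun y hy => ?_
    rw [vInChart, dChart_bumpField γ χ ((extChartAt _ c).map_target hy),
      (extChartAt _ c).right_inv hy]
    rfl

/-- The gradient is the Euclidean one of the chart, so pairing it with `γ` gives a sum of squares of
coefficients, without the metric. -/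
theorem oneForm_bumpField (γ : DForm m M 1) (χ : M → ℝ) {x : M}
    (hx : x ∈ (extChartAt (𝓡∂ (m + 1)) c).source) :
    γ x (fun _ => bumpField γ c χ x) = χ x * ∑ k, (inChart γ c (extChartAt (𝓡∂ (m + 1)) c x)
      (fun _ => stdE m k)) ^ 2 := by
  conv_lhs => rw [eq_inChart_comp γ hx]
  rw [ContinuousAlternatingMap.compContinuousLinearMap_apply]
  have h : (⇑(dChart c x) ∘ fun _ : Fin 1 => bumpField γ c χ x) =
      fun _ => χ x • chartGrad γ c (extChartAt (𝓡∂ (m + 1)) c x) :=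
    funext fun _ => dChart_bumpField γ χ hx
  rw [h]
  let ℓ := (ContinuousAlternatingMap.ofSubsingleton ℝ (EuclideanSpace ℝ (Fin (m + 1))) ℝ
    (0 : Fin 1)).symm (inChart γ c (extChartAt (𝓡∂ (m + 1)) c x))
  change ℓ (χ x • chartGrad γ c _) = _
  rw [chartGrad, map_smul, map_sum, smul_eq_mul]
  congr 1
  refine Finset.sum_congr rfl fun k _ => ?_
  rw [map_smul, sq]
  rfl

theorem oneForm_eq_zero_of_coords {γ : DForm m M 1} {x : M}
    (h : ∀ k, inChart γ x (extChartAt (𝓡∂ (m + 1)) x x) (fun _ => stdE m k) = 0) : γ x = 0 := by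
  rw [eq_inChart_comp γ (mem_extChartAt_source x)]
  let ℓ := (ContinuousAlternatingMap.ofSubsingleton ℝ (EuclideanSpace ℝ (Fin (m + 1))) ℝ
    (0 : Fin 1)).symm (inChart γ x (extChartAt (𝓡∂ (m + 1)) x x))
  have hℓ : (ℓ : EuclideanSpace ℝ (Fin (m + 1)) →ₗ[ℝ] ℝ) = 0 := by
    refine (EuclideanSpace.basisFun (Fin (m + 1)) ℝ).toBasis.ext fun k => ?_
    rw [basisFun_eq_stdE]
    exact h k
  ext u
  have h2 : (⇑(dChart x x) ∘ u) = fun _ => dChart x x (u 0) :=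
    funext fun l => by rw [Subsingleton.elim l 0]; rfl
  rw [ContinuousAlternatingMap.compContinuousLinearMap_apply, h2]
  exact congrArg (fun L => L (dChart x x (u 0))) hℓ

/-- A smooth `1`-form that vanishes in the interior vanishes. -/
theorem eq_zero_of_interior {γ : DForm m M 1} (hγ : IsSmooth γ)
    (h : ∀ x ∈ (𝓡∂ (m + 1)).interior M, γ x = 0) : γ = 0 := by
  funext x
  refine oneForm_eq_zero_of_coords fun k => ?_
  set y := extChartAt (𝓡∂ (m + 1)) x x with hydef
  have hy : y ∈ (extChartAt (𝓡∂ (m + 1)) x).target := mem_extChartAt_target x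
  have hyr := mem_range_of_mem_target hy
  -- The open half-space is dense in the closed one, so a continuous coefficient that vanishes there
  -- vanishes at `y`.
  have hne : (𝓝[interior (range (𝓡∂ (m + 1)))] y).NeBot :=
    mem_closure_iff_nhdsWithin_neBot.1 ((𝓡∂ (m + 1)).range_subset_closure_interior hyr)
  have hle : 𝓝[interior (range (𝓡∂ (m + 1)))] y ≤ 𝓝[range (𝓡∂ (m + 1))] y :=
    nhdsWithin_mono _ interior_subset
  have hcont := ((contDiffOn_apply (hγ x) (fun _ => stdE m k)).contDiffWithinAt_range
    hy).continuousWithinAt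
  have h0 : (fun z => inChart γ x z (fun _ => stdE m k))
      =ᶠ[𝓝[interior (range (𝓡∂ (m + 1)))] y] fun _ => 0 := by
    filter_upwards [hle (extChartAt_target_mem_nhdsWithin_of_mem hy), self_mem_nhdsWithin]
      with z hz hzi
    have : γ ((extChartAt (𝓡∂ (m + 1)) x).symm z) = 0 :=
      h _ ((isInteriorPoint_symm_iff hz).2 (mem_interior_target hz hzi))
    rw [inChart, this]
    rfl
  exact tendsto_nhds_unique (hcont.tendsto.mono_left hle) (tendsto_const_nhds.congr' h0.symm)

variable [RiemannianBundle (fun x : M => TangentSpace (𝓡∂ (m + 1)) x)]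

variable [CompactSpace M] [T2Space M]

/-- Points with `y 0 = 0` are not interior to the half-space, so `η` vanishes at every point the
boundary integral sees. -/
theorem integralBdry_eq_zero (o : ManifoldOrientation m M) {η : DForm m M m}
    (h : closure {x : M | η x ≠ 0} ⊆ (𝓡∂ (m + 1)).interior M) : integralBdry o η = 0 := by
  rw [integralBdry_eq_sum]
  refine Finset.sum_eq_zero fun i _ => setIntegral_eq_zero_of_forall_eq_zero fun y hy => ?_
  have hx : η ((extChartAt (𝓡∂ (m + 1)) i).symm (bdryIncl m y)) = 0 := by
    by_contra hne
    have h1 := interior_mono (extChartAt_target_subset_range i)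
      ((isInteriorPoint_symm_iff hy).1 (h (subset_closure hne)))
    rw [range_model_eq, interior_halfSpace] at h1
    exact lt_irrefl _ (lt_of_lt_of_eq h1 (bdryIncl_apply_zero y))
  rw [traceInChart, inChart, hx]
  exact mul_zero _

variable [IsContMDiffRiemannianBundle (𝓡∂ (m + 1)) ∞ (EuclideanSpace ℝ (Fin (m + 1)))
    (fun x : M => TangentSpace (𝓡∂ (m + 1)) x)]

/-- A nonnegative density that is positive at an interior point has positive integral. -/
theorem sum_integral_density_pos (o : ManifoldOrientation m M) {g : M → ℝ}
    (hg : ∀ i : M, ContDiffOn ℝ ∞ (fInChart g i) (extChartAt (𝓡∂ (m + 1)) i).target)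
    (hg0 : ∀ x, 0 ≤ g x) {x₀ : M} (hx₀ : x₀ ∈ (𝓡∂ (m + 1)).interior M) (hpos : 0 < g x₀) :
    0 < ∑ i ∈ chartIdx m M, ∫ y in (extChartAt (𝓡∂ (m + 1)) i).target, chartSign o.orient i y *
      fInChart (chartPOU m M i) i y * (fInChart g i y * topCoef (vol o) i y) := by
  have hnn : ∀ (i : M) y, 0 ≤ chartSign o.orient i y *
      fInChart (chartPOU m M i) i y * (fInChart g i y * topCoef (vol o) i y) := fun i y => by
    have h1 := (chartPOU m M).nonneg i ((extChartAt (𝓡∂ (m + 1)) i).symm y)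
    have h2 := hg0 ((extChartAt (𝓡∂ (m + 1)) i).symm y)
    have h3 := chartSign_mul_topCoef_vol o i y
    calc 0 ≤ fInChart (chartPOU m M i) i y * fInChart g i y * |topCoef (vol o) i y| :=
          mul_nonneg (mul_nonneg h1 h2) (abs_nonneg _)
      _ = _ := by rw [← h3]; ring
  obtain ⟨i, hi, hρ⟩ : ∃ i ∈ chartIdx m M, 0 < chartPOU m M i x₀ := by
    by_contra! hcon
    have := Finset.sum_nonpos hcon
    rw [sum_chartPOU] at this
    linarith
  refine Finset.sum_pos' (fun k _ => setIntegral_nonneg (measurableSet_target k)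
    fun y _ => hnn k y) ⟨i, hi, ?_⟩
  have hsrc : x₀ ∈ (extChartAt (𝓡∂ (m + 1)) i).source :=
    chartPOU_tsupport_subset i (subset_tsupport _ hρ.ne')
  set y₀ := extChartAt (𝓡∂ (m + 1)) i x₀ with hy₀def
  have hy₀ : y₀ ∈ (extChartAt (𝓡∂ (m + 1)) i).target := (extChartAt _ i).map_source hsrc
  have hsy : (extChartAt (𝓡∂ (m + 1)) i).symm y₀ = x₀ := (extChartAt _ i).left_inv hsrc
  have hyint : y₀ ∈ interior (extChartAt (𝓡∂ (m + 1)) i).target := by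
    rw [← isInteriorPoint_symm_iff hy₀, hsy]
    exact hx₀
  have hgv : ContinuousOn (fun y => fInChart g i y * topCoef (vol o) i y)
      (extChartAt (𝓡∂ (m + 1)) i).target :=
    ((hg i).mul (contDiffOn_topCoef_vol o i)).continuousOn
  rw [setIntegral_pos_iff_support_of_nonneg_ae (Eventually.of_forall fun y => hnn i y)
    (integrableOn_chartPOU_mul o hgv)]
  have hcts : ContinuousAt (fun y => chartSign o.orient i y *
      fInChart (chartPOU m M i) i y * (fInChart g i y * topCoef (vol o) i y)) y₀ :=
    ((((contDiffOn_chartSign o i).mul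
      (isSmooth_zero_iff.1 (isSmooth_chartPOU i) i)).continuousOn.mul hgv) y₀ hy₀).continuousAt
        (mem_interior_iff_mem_nhds.1 hyint)
  have hne : chartSign o.orient i y₀ * fInChart (chartPOU m M i) i y₀ *
      (fInChart g i y₀ * topCoef (vol o) i y₀) ≠ 0 := by
    have hs : chartSign o.orient i y₀ ≠ 0 := by
      rcases chartSign_eq_or o hy₀ with h | h <;> rw [h] <;> norm_num
    refine mul_ne_zero (mul_ne_zero hs ?_) (mul_ne_zero ?_ (topCoef_vol_ne_zero o hy₀))
    · rw [fInChart, hsy]; exact hρ.ne'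
    · rw [fInChart, hsy]; exact hpos.ne'
  -- As `y₀` is interior to the target, the integrand is continuous and nonzero at `y₀`, hence
  -- nonzero on a full neighbourhood, which has positive measure.
  refine Measure.measure_pos_of_mem_nhds volume (x := y₀)
    (inter_mem ?_ (mem_interior_iff_mem_nhds.1 hyint))
  exact hcts.eventually_ne hne

/-- Smooth `1`-forms are separated by the `m`-forms supported in the interior. -/
theorem eq_of_pairing_eq (o : ManifoldOrientation m M) {α β : DForm m M 1} (hα : IsSmooth α)
    (hβ : IsSmooth β) (h : ∀ w : DForm m M m, IsSmooth w →
      closure {x : M | w x ≠ 0} ⊆ (𝓡∂ (m + 1)).interior M →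
      pairing (Nat.add_comm 1 m) o α w = pairing (Nat.add_comm 1 m) o β w) : α = β := by
  have hγ := hα.sub hβ
  refine sub_eq_zero.1 (eq_zero_of_interior hγ fun c hc => ?_)
  by_contra hne
  obtain ⟨k, hk⟩ : ∃ k, inChart (α - β) c (extChartAt (𝓡∂ (m + 1)) c c)
      (fun _ => stdE m k) ≠ 0 := by
    by_contra! hcon
    exact hne (oneForm_eq_zero_of_coords hcon)
  have hnhds : (𝓡∂ (m + 1)).interior M ∈ 𝓝 c :=
    ((𝓡∂ (m + 1)).isOpen_interior (n := ∞) (by simp)).mem_nhds hc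
  obtain ⟨χ, -, hχ⟩ := (SmoothBumpFunction.nhds_basis_tsupport (I := 𝓡∂ (m + 1)) c).mem_iff.1 hnhds
  have hχsrc := χ.tsupport_subset_extChartAt_source
  have hχs : IsSmooth (ofFun χ : DForm m M 0) := isSmooth_ofFun χ.contMDiff
  -- The test form is `ι_v vol`: the difference of the two pairings becomes the integral of `(α -
  -- β)(v)`, which is nonnegative everywhere and positive at `c`.
  set v := bumpField (α - β) c χ with hv
  have hvs : IsSmoothV v := isSmoothV_bumpField hγ hχs hχsrc
  have hws := isSmooth_contract_vol o hvs
  have hv0 : ∀ x, x ∉ tsupport χ → v x = 0 := fun x hx => by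
    rw [hv, bumpField, image_eq_zero_of_notMem_tsupport hx, zero_smul]
  have hsupp : closure {x : M | contract v (vol o) x ≠ 0} ⊆ (𝓡∂ (m + 1)).interior M := by
    refine Subset.trans (closure_minimal (fun x hx => ?_) (isClosed_tsupport χ)) hχ
    by_contra hx'
    refine hx ?_
    rw [contract, hv0 x hx']
    have := interiorAt_smul (0 : ℝ) (0 : TangentSpace (𝓡∂ (m + 1)) x) (vol o x)
    rwa [zero_smul, zero_smul] at this
  have heq := h _ hws hsupp
  rw [← sub_eq_zero, pairing, pairing, integralM_sub o (isSmooth_wedge_one _ o hα hws)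
    (isSmooth_wedge_one _ o hβ hws)] at heq
  let g : M → ℝ := fun x => (α - β) x (fun _ => v x)
  have hval : ∀ x ∈ (extChartAt (𝓡∂ (m + 1)) c).source, g x = χ x *
      ∑ k, (inChart (α - β) c (extChartAt (𝓡∂ (m + 1)) c x) (fun _ => stdE m k)) ^ 2 :=
    fun x hx => oneForm_bumpField (α - β) χ hx
  have hg0 : ∀ x, 0 ≤ g x := fun x => by
    by_cases hx : x ∈ tsupport χ
    · rw [hval x (hχsrc hx)]
      exact mul_nonneg χ.nonneg (Finset.sum_nonneg fun k _ => sq_nonneg _)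
    · refine le_of_eq ?_
      simp only [g, hv0 x hx]
      exact ((α - β) x).map_coord_zero (0 : Fin 1) rfl |>.symm
  have hgc : 0 < g c := by
    rw [hval c (mem_extChartAt_source c), χ.eq_one, one_mul]
    exact Finset.sum_pos' (fun k _ => sq_nonneg _) ⟨k, Finset.mem_univ k, by positivity⟩
  have hpos := sum_integral_density_pos o (contDiffOn_oneForm_apply hγ hvs) hg0 hc hgc
  refine hpos.ne' (Eq.trans ?_ heq)
  refine Finset.sum_congr rfl fun i _ => setIntegral_congr_fun (measurableSet_target i)
    fun y _ => ?_
  simp only [wedge_one _ o, hat_contract, topCoef_density]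
  rw [← sub_mul]
  rfl

/-- Interior test forms separate smooth 1-forms, so one known dual fixes all others on smooth
`abar`; on non-smooth `abar` the definition imposes nothing. -/
theorem isFormalDual_iff {k l : ℕ} {h : k + l = m + 1} {o : ManifoldOrientation m M}
    {φ : DForm m M m → DForm m M l} {ψ₀ : DForm m M k → DForm m M 1}
    (hψ₀ : IsFormalDual h o φ ψ₀) (ψ : DForm m M k → DForm m M 1) :
    IsFormalDual h o φ ψ ↔ ∀ abar : DForm m M k, IsSmooth abar → ψ abar = ψ₀ abar := by
  refine ⟨fun hψ abar ha => ?_, fun hψ abar ha => ?_⟩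
  · exact eq_of_pairing_eq o (hψ abar ha).1 (hψ₀ abar ha).1 fun w hw hws =>
      ((hψ abar ha).2 w hw hws).trans ((hψ₀ abar ha).2 w hw hws).symm
  · rw [hψ abar ha]
    exact hψ₀ abar ha

end Uniqueness

end FluidForms

end

/-! ### Assembly of the two cases -/

open FluidForms in
theorem proposition3 {m : ℕ} {M : Type*} [TopologicalSpace M]
    [ChartedSpace (EuclideanHalfSpace (m + 1)) M] [IsManifold (𝓡∂ (m + 1)) ∞ M]
    [CompactSpace M] [T2Space M]
    [RiemannianBundle (fun x : M => TangentSpace (𝓡∂ (m + 1)) x)]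
    [IsContMDiffRiemannianBundle (𝓡∂ (m + 1)) ∞ (EuclideanSpace ℝ (Fin (m + 1)))
      (fun x : M => TangentSpace (𝓡∂ (m + 1)) x)]
    (o : ManifoldOrientation m M) :
    -- `V = Ω^0(M)`, `V^* = Ω^n(M)`, `n = m + 1`
    (∀ a : DForm m M (m + 1), IsSmooth a →
      (∀ w : DForm m M m, IsSmooth w → IsSmooth (interconnection o a w)) ∧
      (∀ ψ : DForm m M 0 → DForm m M 1,
        IsFormalDual (Nat.zero_add (m + 1)) o (interconnection o a) ψ ↔
          ∀ abar : DForm m M 0, IsSmooth abar →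
            ψ abar = -fsmul (star (Nat.zero_add (m + 1)) o a) (extD abar)) ∧
      HasSurfaceTerm (Nat.zero_add (m + 1)) o (interconnection o a)
        (fun abar => -fsmul (star (Nat.zero_add (m + 1)) o a) (extD abar))
        (fun w abar => -wedge (Nat.add_zero m)
          (fsmul (star (Nat.zero_add (m + 1)) o a) w) abar)) ∧
    -- `V = Ω^n(M)`, `V^* = Ω^0(M)`
    (∀ a : DForm m M 0, IsSmooth a →
      (∀ w : DForm m M m, IsSmooth w → IsSmooth (interconnection o a w)) ∧
      (∀ ψ : DForm m M (m + 1) → DForm m M 1,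
        IsFormalDual (Nat.add_zero (m + 1)) o (interconnection o a) ψ ↔
          ∀ abar : DForm m M (m + 1), IsSmooth abar →
            ψ abar = fsmul (star (Nat.zero_add (m + 1)) o abar) (extD a)) ∧
      HasSurfaceTerm (Nat.add_zero (m + 1)) o (interconnection o a)
        (fun abar => fsmul (star (Nat.zero_add (m + 1)) o abar) (extD a))
        (fun _ _ => 0)) := by
  refine ⟨fun a ha => ⟨fun w hw => IsSmooth.lieD_top (isSmoothV_hat o hw) ha,
    isFormalDual_iff ?_, ?_⟩, fun a ha => ⟨fun w hw => IsSmooth.lieD_zero (isSmoothV_hat o hw) ha,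
    isFormalDual_iff ?_, ?_⟩⟩
  · intro abar habar
    refine ⟨((isSmooth_star _ o ha).fsmul habar.extD_zero).neg, fun w hw hws => ?_⟩
    rw [pairing_lieD_top o ha hw habar, integralBdry_eq_zero, add_zero]
    -- The surface term is a multiple of `w` at each point, so it inherits the support in the
    -- interior and its boundary integral vanishes.
    refine (closure_mono ?_).trans hws
    intro x hx hwx
    apply hx
    rw [wedge_zero_right, Pi.neg_apply, fsmul, fsmul, hwx]
    ext u
    simp
  · intro w abar hw habar
    refine ⟨?_, pairing_lieD_top o ha hw habar⟩
    beta_reduce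
    rw [wedge_zero_right]
    exact (habar.fsmul ((isSmooth_star _ o ha).fsmul hw)).neg
  · intro abar habar
    exact ⟨(isSmooth_star _ o habar).fsmul ha.extD_zero, fun w _ _ => pairing_lieD_zero o a w abar⟩
  · intro w abar hw habar
    refine ⟨fun i => contDiffOn_const (c := 0), ?_⟩
    rw [pairing_lieD_zero o a w abar, integralBdry_eq_zero, add_zero]
    simp
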